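/- Let $q$ be a complex number with $0<|q|<1$. For $x\in\mathbb{C}$ put $(x)_0=1$, $(x)_n=\prod_{j=0}^{n-1}(1-xq^j)$ and $(x)_{-n}=\bigl[\prod_{j=1}^{n}(1-xq^{-j})\bigr]^{-1}$ for $n\ge 1$, so that $1/(x)_{-n}=\prod_{j=1}^{n}(1-xq^{-j})$, which may be $0$ (in particular $1/(q)_{-n}=0$ for $n\ge1$). Write $(x_1,\dots,x_m)_k=(x_1)_k\cdots(x_m)_k$ and $(x_1,\dots,x_m)_\infty=\lim_{k\to\infty}(x_1,\dots,x_m)_k$. (i) Let $a,b,c,d,e$ be nonzero complex numbers, at least one of $a,b,c$ being equal to $q^n$ for an integer $n\ge1$. Assume that no denominator vanishes, i.e. for integers $i$: $a,b,c\ne q^i$ whenever $i\le 0$; $abc\neq q^i$ whenever $i\le n+1$; $d,e\neq q^i$ whenever $2-n\le i\le 1$. Then $$\sum_{k=-\infty}^{\infty}\frac{(q/a,q/b,q/c,q/d,q/e)_k}{(a,b,c,d/q,e/q)_k}(abcdeq^{-3})^k=\frac{(q,ab/q,bc/q,ac/q)_\infty}{(a,b,c,abc/q^2)_\infty}\sum_{k=0}^{\infty}\frac{(q/a,q/b,q/c,de/q^2)_k}{(q,q^3/abc,d,e)_k}q^k$$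 and $$\sum_{k=-\infty}^{\infty}\frac{(q/a,q/b,q/c,q/d,q/e)_k}{(a,b,c,d/q,e/q)_k}(abcdeq^{-4})^k=\frac{(q,ab/q,bc/q,ac/q)_\infty}{(a,b,c,abc/q^2)_\infty}\sum_{k=0}^{\infty}\frac{(q/a,q/b,q/c,de/q^2)_k}{(q,q^3/abc,d,e)_k}q^{2k}.$$ All four sums terminate: the terms with $|k|\ge n$ are $0$ (also where one of their denominators vanishes). (ii) For all integers $l,m,n\ge0$ and $u,v\ge1$, $$\sum_{k=0}^\infty\frac{q^{k^2}(q)_{l+m+n-k}(q)_{u+v+k-1}}{(q)_k(q)_{l-k}(q)_{m-k}(q)_{n-k}(q)_{u+k}(q)_{v+k}}=\sum_{k=-\infty}^\infty\frac{(-1)^kq^{(5k^2-k)/2}(q)_{l+m}(q)_{l+n}(q)_{m+n}(q)_{u-1}(q)_{v-1}(q)_{u+v-1}}{(q)_{l-k}(q)_{m-k}(q)_{n-k}(q)_{u-k}(q)_{v-k}(q)_{l+k}(q)_{m+k}(q)_{n+k}(q)_{u+k-1}(q)_{v+k-1}}$$ and $$\sum_{k=0}^\infty\frac{q^{k^2+k}(q)_{l+m+n-k}(q)_{u+v+k-1}}{(q)_k(q)_{l-k}(q)_{m-k}(q)_{n-k}(q)_{u+k}(q)_{v+k}}=\sum_{k=-\infty}^\infty\frac{(-1)^kq^{(5k^2-3k)/2}(q)_{l+m}(q)_{l+n}(q)_{m+n}(q)_{u-1}(q)_{v-1}(q)_{u+v-1}}{(q)_{l-k}(q)_{m-k}(q)_{n-k}(q)_{u-k}(q)_{v-k}(q)_{l+k}(q)_{m+k}(q)_{n+k}(q)_{u+k-1}(q)_{v+k-1}}.$$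 Again all sums terminate (the terms containing $1/(q)_j$ with $j<0$ are $0$). -/

import Mathlib

open scoped BigOperators Topology

noncomputable section

/-- The `q`-shifted factorial `(x)_n = (x; q)_n` for an integer `n`:
`(1 - x)(1 - xq)⋯(1 - xq^{n-1})` for `n ≥ 0`, and
`[(1 - xq^{-1})(1 - xq^{-2})⋯(1 - xq^{n})]⁻¹` for `n < 0`.
If a factor in the latter bracket vanishes, the value is `0` by the convention `0⁻¹ = 0`; then
`1 / (x)_n` is `0` too, which is its usual value (see `one_div_qPoch_neg`). -/
def qPoch (q x : ℂ) : ℤ → ℂ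
  | Int.ofNat n => ∏ j ∈ Finset.range n, (1 - x * q ^ j)
  | Int.negSucc n => (∏ j ∈ Finset.range (n + 1), (1 - x * (q ^ (j + 1))⁻¹))⁻¹

/-- The compact notation `(x₁, …, x_m)_n = (x₁)_n ⋯ (x_m)_n`. -/
def qPochs (q : ℂ) (xs : List ℂ) (n : ℤ) : ℂ := (xs.map fun x => qPoch q x n).prod

/-- The infinite product `(x)_∞ = ∏_{j ≥ 0} (1 - x q^j)`. -/
def qPochInf (q x : ℂ) : ℂ := ∏' j : ℕ, (1 - x * q ^ j)

/-- The compact notation `(x₁, …, x_m)_∞ = (x₁)_∞ ⋯ (x_m)_∞`; for `|q| < 1` this is the limit of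
`(x₁, …, x_m)_n` as `n → ∞` (see `tendsto_qPochs`). -/
def qPochsInf (q : ℂ) (xs : List ℂ) : ℂ := (xs.map fun x => qPochInf q x).prod

/-- The reciprocal `1 / (x)_{-n}` is `(1 - xq^{-1})⋯(1 - xq^{-n})`, also where this is `0`. -/
theorem one_div_qPoch_neg (q x : ℂ) (n : ℕ) :
    1 / qPoch q x (-(n : ℤ)) = ∏ j ∈ Finset.range n, (1 - x * (q ^ (j + 1))⁻¹) := by
  cases n with
  | zero =>
    have : qPoch q x 0 = 1 := by
      change ∏ j ∈ Finset.range 0, (1 - x * q ^ j) = 1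
      simp
    simp [this]
  | succ n =>
    have : qPoch q x (-((n + 1 : ℕ) : ℤ))
        = (∏ j ∈ Finset.range (n + 1), (1 - x * (q ^ (j + 1))⁻¹))⁻¹ := rfl
    rw [this, one_div, inv_inv]

theorem tendsto_qPoch {q : ℂ} (hq : ‖q‖ < 1) (x : ℂ) :
    Filter.Tendsto (fun n : ℕ => qPoch q x (n : ℤ)) Filter.atTop (𝓝 (qPochInf q x)) := by
  have hs : Summable fun j : ℕ => ‖-(x * q ^ j)‖ := by
    simp only [norm_neg, norm_mul, norm_pow]
    exact (summable_geometric_of_lt_one (norm_nonneg q) hq).mul_left _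
  have hm := multipliable_one_add_of_summable hs
  have := hm.tendsto_prod_tprod_nat
  simpa [qPochInf, qPoch, sub_eq_add_neg] using this

theorem tendsto_qPochs {q : ℂ} (hq : ‖q‖ < 1) (xs : List ℂ) :
    Filter.Tendsto (fun n : ℕ => qPochs q xs (n : ℤ)) Filter.atTop (𝓝 (qPochsInf q xs)) := by
  induction xs with
  | nil => simp [qPochs, qPochsInf]
  | cons x xs ih =>
    simpa [qPochs, qPochsInf] using (tendsto_qPoch hq x).mul ih

/-- Left-hand summand
`(q/a,q/b,q/c,q/d,q/e)_k / (a,b,c,d/q,e/q)_k · (abcde q^{-s})^k`. -/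
def bilateralTerm (q a b c d e : ℂ) (s : ℕ) (k : ℤ) : ℂ :=
  qPochs q [q / a, q / b, q / c, q / d, q / e] k / qPochs q [a, b, c, d / q, e / q] k
    * (a * b * c * d * e / q ^ s) ^ k

/-- Right-hand summand `(q/a,q/b,q/c,de/q²)_k / (q,q³/abc,d,e)_k · q^{tk}`. -/
def unilateralTerm (q a b c d e : ℂ) (t : ℕ) (k : ℕ) : ℂ :=
  qPochs q [q / a, q / b, q / c, d * e / q ^ 2] k / qPochs q [q, q ^ 3 / (a * b * c), d, e] k
    * q ^ (t * k)

/-- The prefactor `(q,ab/q,bc/q,ac/q)_∞ / (a,b,c,abc/q²)_∞`. -/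
def prefactor (q a b c : ℂ) : ℂ :=
  qPochsInf q [q, a * b / q, b * c / q, a * c / q] / qPochsInf q [a, b, c, a * b * c / q ^ 2]

/-- The summand
`q^{k² + tk} (q)_{l+m+n-k} (q)_{u+v+k-1} / ((q)_k (q)_{l-k} (q)_{m-k} (q)_{n-k} (q)_{u+k} (q)_{v+k})`. -/
def finiteRRLeftTerm (q : ℂ) (l m n u v : ℕ) (t : ℕ) (k : ℕ) : ℂ :=
  q ^ (k ^ 2 + t * k) * (qPoch q q ((l : ℤ) + m + n - k) * qPoch q q ((u : ℤ) + v + k - 1))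
    / (qPoch q q k * qPoch q q ((l : ℤ) - k) * qPoch q q ((m : ℤ) - k) * qPoch q q ((n : ℤ) - k)
      * qPoch q q ((u : ℤ) + k) * qPoch q q ((v : ℤ) + k))

/-- The summand with numerator
`(-1)^k q^{(5k² - rk)/2} (q)_{l+m} (q)_{l+n} (q)_{m+n} (q)_{u-1} (q)_{v-1} (q)_{u+v-1}` and denominator
`(q)_{l-k} (q)_{m-k} (q)_{n-k} (q)_{u-k} (q)_{v-k} (q)_{l+k} (q)_{m+k} (q)_{n+k} (q)_{u+k-1} (q)_{v+k-1}`.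
It is used for odd `r` only, where `5k² - rk` is even, so that the integer division is exact. -/
def finiteRRRightTerm (q : ℂ) (l m n u v : ℕ) (r : ℤ) (k : ℤ) : ℂ :=
  (-1) ^ k * q ^ ((5 * k ^ 2 - r * k) / 2)
    * (qPoch q q ((l : ℤ) + m) * qPoch q q ((l : ℤ) + n) * qPoch q q ((m : ℤ) + n)
      * qPoch q q ((u : ℤ) - 1) * qPoch q q ((v : ℤ) - 1) * qPoch q q ((u : ℤ) + v - 1))
    / (qPoch q q ((l : ℤ) - k) * qPoch q q ((m : ℤ) - k) * qPoch q q ((n : ℤ) - k)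
      * qPoch q q ((u : ℤ) - k) * qPoch q q ((v : ℤ) - k)
      * qPoch q q ((l : ℤ) + k) * qPoch q q ((m : ℤ) + k) * qPoch q q ((n : ℤ) + k)
      * qPoch q q ((u : ℤ) + k - 1) * qPoch q q ((v : ℤ) + k - 1))

end

/-! The transformations come from a finite form of Bailey's lemma. By symmetry in `a`, `b`, `c`,
take `a = q^(N+1)` with `N = n - 1`; the factor `(q^{-N})_k` then cuts off both sides.

The bilateral sum is folded by pairing `k = -i` with `k = i + 1`, for `0 ≤ i ≤ N`. Both summands of
a pair carry the same factor `W_i` in `d`, `e` (`wellPoisedFactor`). Up to a common constant the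
pair is `W_i (u_i β_i - v_i β_{i+1})`, where `β_i` is `baileyCoeff` and `u_i`, `v_i` are powers of
`q`.

By q-Pfaff–Saalschütz, `β_i (b)_N (c)_N` is a sum over `j` of weights times `1/((q)_{j-i}
(q)_{j+i})` (`baileyCoeff_mul`). The combination of `β_i` and `β_{i+1}` moves this kernel from base
`1` to base `q`, giving `q^{rj} (1 - q^{2i+1}) / ((q)_{j-i} (q)_{j+i+1})`; `r = 0` and `r = 1` are
the two transformations. After interchanging the sums, the sum over `i` is a terminating
very-well-poised `₆φ₅`, summed in closed form by `wellPoised_sum`. What remains is a sum over `j`,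
and reversing factors in the weights turns it into the unilateral series (`unilateralTerm_eq`).

Part (ii) is the case where `a, b, c, d, e` are `q^{l+1}, q^{m+1}, q^{n+1}, q^{u+1}, q^{v+1}`: each
summand is then a nonzero constant multiple of the corresponding summand in (i). -/

noncomputable section

/-! ### Shifted factorials and their reciprocals. -/

/-- The `q`-shifted factorial `(x)_n` with a natural index. -/
def qShift (q x : ℂ) (n : ℕ) : ℂ := ∏ j ∈ Finset.range n, (1 - x * q ^ j)

/-- The reciprocal `1 / (q)_k`, which is `0` for `k < 0`. -/
def qRecip (q : ℂ) (k : ℤ) : ℂ := (qPoch q q k)⁻¹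

theorem qPoch_natCast (q x : ℂ) (n : ℕ) : qPoch q x (n : ℤ) = qShift q x n := rfl

@[simp] theorem qShift_zero (q x : ℂ) : qShift q x 0 = 1 := by simp [qShift]

theorem qShift_succ (q x : ℂ) (n : ℕ) :
    qShift q x (n + 1) = qShift q x n * (1 - x * q ^ n) := by
  simp [qShift, Finset.prod_range_succ]

theorem qShift_add (q x : ℂ) (m n : ℕ) :
    qShift q x (m + n) = qShift q x m * qShift q (x * q ^ m) n := by
  simp only [qShift, Finset.prod_range_add]
  congr 1
  exact Finset.prod_congr rfl fun j _ => by ring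

theorem qShift_succ' (q x : ℂ) (n : ℕ) :
    qShift q x (n + 1) = (1 - x) * qShift q (x * q) n := by
  rw [add_comm, qShift_add]; simp [qShift_succ]

theorem qShift_ne_zero {q x : ℂ} {n : ℕ} (h : ∀ j < n, 1 - x * q ^ j ≠ 0) :
    qShift q x n ≠ 0 :=
  Finset.prod_ne_zero_iff.mpr fun j hj => h j (Finset.mem_range.mp hj)

theorem qShift_self_ne_zero {q : ℂ} (h1 : ∀ n : ℕ, 1 - q ^ (n + 1) ≠ 0) (n : ℕ) :
    qShift q q n ≠ 0 :=
  qShift_ne_zero fun j _ => by simpa [pow_succ'] using h1 j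

/-- Reversal of the order of the last `j` factors of `(y)_{M+j}`. -/
theorem qShift_reverse {q y : ℂ} (hq : q ≠ 0) (hy : y ≠ 0) (M j : ℕ) :
    qShift q y (M + j) = qShift q y M * (qShift q (q ^ (1 - ((M + j : ℕ) : ℤ)) / y) j
      * ∏ i ∈ Finset.range j, (-(y * q ^ ((M + j : ℕ) - 1 - (i : ℤ))))) := by
  rw [qShift_add]
  congr 1
  rw [qShift, qShift, ← Finset.prod_mul_distrib, ← Finset.prod_range_reflect]
  refine Finset.prod_congr rfl fun i hi => ?_
  have hi' : i < j := Finset.mem_range.mp hi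
  have e1 : y * q ^ M * q ^ (j - 1 - i) = y * q ^ ((M + j : ℕ) - 1 - (i : ℤ)) := by
    rw [mul_assoc, ← pow_add, ← zpow_natCast]
    congr 2
    omega
  have e2 : q ^ (1 - ((M + j : ℕ) : ℤ)) * q ^ i * q ^ ((M + j : ℕ) - 1 - (i : ℤ)) = 1 := by
    rw [← zpow_natCast, ← zpow_add₀ hq, ← zpow_add₀ hq]
    convert zpow_zero q using 2
    ring
  rw [e1]
  have : q ^ (1 - ((M + j : ℕ) : ℤ)) / y * q ^ i * (y * q ^ ((M + j : ℕ) - 1 - (i : ℤ))) = 1 := by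
    rw [← e2]; field_simp
  linear_combination (-1) * this

/-- `(x)_{-k}` in terms of `(q/x)_k`. -/
theorem qPoch_neg {q x : ℂ} (hq : q ≠ 0) (hx : x ≠ 0) (k : ℕ) :
    qPoch q x (-(k : ℤ))
      = (qShift q (q / x) k * ∏ j ∈ Finset.range k, (-(x / q ^ (j + 1))))⁻¹ := by
  rw [← inv_inv (qPoch q x _), ← one_div (qPoch q x _), one_div_qPoch_neg, qShift,
    ← Finset.prod_mul_distrib]
  congr 1
  refine Finset.prod_congr rfl fun j _ => ?_
  field_simp
  ring

theorem qRecip_natCast (q : ℂ) (n : ℕ) : qRecip q (n : ℤ) = (qShift q q n)⁻¹ := rfl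

@[simp] theorem qRecip_zero (q : ℂ) : qRecip q 0 = 1 := by
  simpa using qRecip_natCast q 0

theorem qRecip_neg {q : ℂ} (hq : q ≠ 0) {k : ℤ} (hk : k < 0) : qRecip q k = 0 := by
  obtain ⟨n, rfl⟩ : ∃ n : ℕ, k = -((n + 1 : ℕ) : ℤ) := ⟨(-k - 1).toNat, by omega⟩
  rw [qRecip, ← one_div, one_div_qPoch_neg]
  exact Finset.prod_eq_zero (i := 0) (by simp) (by simp [hq])

/-- At `k = 0` the factor `1 - q^k` vanishes together with `1/(q)_{-1}`, so one recurrence holds on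
all of `ℤ`. Sums cut off by `qRecip` can therefore be shifted without separate boundary terms. -/
theorem qRecip_sub_one {q : ℂ} (hq : q ≠ 0) (h1 : ∀ n : ℕ, 1 - q ^ (n + 1) ≠ 0) (k : ℤ) :
    qRecip q (k - 1) = (1 - q ^ k) * qRecip q k := by
  rcases lt_trichotomy k 0 with h | rfl | h
  · rw [qRecip_neg hq h, qRecip_neg hq (by omega), mul_zero]
  · rw [qRecip_neg hq (by omega)]; simp
  · obtain ⟨n, rfl⟩ : ∃ n : ℕ, k = ((n + 1 : ℕ) : ℤ) := ⟨(k - 1).toNat, by omega⟩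
    have : ((n + 1 : ℕ) : ℤ) - 1 = (n : ℤ) := by push_cast; ring
    rw [this, qRecip_natCast, qRecip_natCast, qShift_succ, zpow_natCast]
    have := h1 n
    have := qShift_self_ne_zero h1 n
    have e : q * q ^ n = q ^ (n + 1) := by ring
    rw [e]
    field_simp

theorem qRecip_nat_succ {q : ℂ} (hq : q ≠ 0) (h1 : ∀ n : ℕ, 1 - q ^ (n + 1) ≠ 0) (n : ℕ) :
    (1 - q ^ (n + 1)) * qRecip q ((n + 1 : ℕ) : ℤ) = qRecip q (n : ℤ) := by
  have := qRecip_sub_one hq h1 ((n + 1 : ℕ) : ℤ)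
  rw [zpow_natCast] at this
  rw [← this]
  congr 1
  push_cast; ring

/-! ### The q-Pfaff–Saalschütz sum. -/

theorem sum_antidiagonal_shift {H K : ℕ → ℕ → ℂ} (h0 : ∀ i, H i 0 = 0) (k0 : ∀ h, K 0 h = 0)
    (M : ℕ) (hs : ∀ i h, i + h + 1 = M → H i (h + 1) = K (i + 1) h) :
    ∑ p ∈ Finset.HasAntidiagonal.antidiagonal M, H p.1 p.2 = ∑ p ∈ Finset.HasAntidiagonal.antidiagonal M, K p.1 p.2 := by
  cases M with
  | zero => simp [h0, k0]
  | succ m =>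
    rw [Finset.Nat.sum_antidiagonal_succ', Finset.Nat.sum_antidiagonal_succ]
    simp only [h0, k0, zero_add]
    refine Finset.sum_congr rfl fun p hp => hs _ _ ?_
    rw [Finset.HasAntidiagonal.mem_antidiagonal.mp hp]

/-- The `q`-Pfaff–Saalschütz sum, in a form without denominators depending on the parameters. -/
theorem qPfaffSaalschutz {q : ℂ} (hq : q ≠ 0) (h1 : ∀ n : ℕ, 1 - q ^ (n + 1) ≠ 0)
    (A B D : ℂ) (M : ℕ) :
    ∑ p ∈ Finset.HasAntidiagonal.antidiagonal M, qRecip q p.1 * qRecip q p.2 * (qShift q A p.1 * qShift q B p.1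
      * qShift q (A * B * D * q ^ p.1) p.2 * qShift q D p.2 * D ^ p.1)
    = qRecip q M * qShift q (A * D) M * qShift q (B * D) M := by
  induction M with
  | zero => simp
  | succ M ih =>
    set F : ℕ → ℕ → ℂ := fun i h => qShift q A i * qShift q B i
      * qShift q (A * B * D * q ^ i) h * qShift q D h * D ^ i with hF
    have hR : ∀ n : ℕ, (1 - q ^ (n + 1)) * qRecip q ((n + 1 : ℕ) : ℤ) = qRecip q (n : ℤ) :=
      qRecip_nat_succ hq h1
    -- On the antidiagonal `i + h = M + 1`, write `1 - q^{i+h} = (1 - q^h) + q^h (1 - q^i)`. Each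
    -- bracket lowers one of the two reciprocals `1/(q)_h`, `1/(q)_i`, which leaves two sums over
    -- the antidiagonal of `M`.
    have step1 : (1 - q ^ (M + 1)) * ∑ p ∈ Finset.HasAntidiagonal.antidiagonal (M + 1),
        qRecip q p.1 * qRecip q p.2 * F p.1 p.2
        = ∑ p ∈ Finset.HasAntidiagonal.antidiagonal M, qRecip q p.1 * qRecip q p.2 * F p.1 (p.2 + 1)
          + ∑ p ∈ Finset.HasAntidiagonal.antidiagonal M,
            q ^ p.2 * (qRecip q p.1 * qRecip q p.2 * F (p.1 + 1) p.2) := by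
      have : ∀ p ∈ Finset.HasAntidiagonal.antidiagonal (M + 1),
          (1 - q ^ (M + 1)) * (qRecip q p.1 * qRecip q p.2 * F p.1 p.2)
          = (1 - q ^ p.2) * (qRecip q p.1 * qRecip q p.2 * F p.1 p.2)
          + q ^ p.2 * (1 - q ^ p.1) * (qRecip q p.1 * qRecip q p.2 * F p.1 p.2) := by
        intro p hp
        rw [← Finset.HasAntidiagonal.mem_antidiagonal.mp hp, pow_add]
        ring
      rw [Finset.mul_sum, Finset.sum_congr rfl this, Finset.sum_add_distrib,
        Finset.Nat.sum_antidiagonal_succ', Finset.Nat.sum_antidiagonal_succ]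
      simp only [pow_zero, sub_self, zero_mul, mul_zero, zero_add]
      congr 1
      · refine Finset.sum_congr rfl fun p _ => ?_
        rw [← hR p.2]; ring
      · refine Finset.sum_congr rfl fun p _ => ?_
        rw [← hR p.1]; ring
    -- For `h ≥ 1` the difference of the two shifted factorials is `ABDq^i (1 - q^h)
    -- (ABDq^{i+1})_{h-1}`. The factor `1 - q^h` is absorbed by `1/(q)_h`, and the index moves from
    -- `(i, h)` to `(i + 1, h - 1)`.
    have step2 : ∑ p ∈ Finset.HasAntidiagonal.antidiagonal M, q ^ p.2 * (qRecip q p.1 * qRecip q p.2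
          * (qShift q A (p.1 + 1) * qShift q B (p.1 + 1) * D ^ (p.1 + 1) * qShift q D p.2
            * (qShift q (A * B * D * q ^ (p.1 + 1)) p.2 - qShift q (A * B * D * q ^ p.1) p.2)))
        = ∑ p ∈ Finset.HasAntidiagonal.antidiagonal M, (1 - q ^ p.1) * (qRecip q p.1 * qRecip q p.2
          * (A * B * D * q ^ M * F p.1 p.2 * (1 - D * q ^ p.2))) := by
      refine sum_antidiagonal_shift
        (H := fun i h => q ^ h * (qRecip q i * qRecip q h
          * (qShift q A (i + 1) * qShift q B (i + 1) * D ^ (i + 1) * qShift q D h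
            * (qShift q (A * B * D * q ^ (i + 1)) h - qShift q (A * B * D * q ^ i) h))))
        (K := fun i h => (1 - q ^ i) * (qRecip q i * qRecip q h
          * (A * B * D * q ^ M * F i h * (1 - D * q ^ h)))) ?_ ?_ M ?_
      · intro i; simp
      · intro h; simp
      · intro i h hM
        subst hM
        rw [qShift_succ q (A * B * D * q ^ (i + 1)), qShift_succ' q (A * B * D * q ^ i),
          qShift_succ q D, ← hR h, ← hR i]
        simp only [hF]
        have e : A * B * D * q ^ i * q = A * B * D * q ^ (i + 1) := by ring
        rw [e]
        ring
    have step3 : (1 - q ^ (M + 1)) * ∑ p ∈ Finset.HasAntidiagonal.antidiagonal (M + 1),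
        qRecip q p.1 * qRecip q p.2 * F p.1 p.2
        = (1 - A * D * q ^ M) * (1 - B * D * q ^ M)
          * ∑ p ∈ Finset.HasAntidiagonal.antidiagonal M, qRecip q p.1 * qRecip q p.2 * F p.1 p.2 := by
      -- Replacing `(ABDq^{i+1})_h` by `(ABDq^i)_h` makes the summand a polynomial multiple of `F i
      -- h`; the error is the sum in `step2`. The multipliers of `F i h` then add up to the constant
      -- `(1 - ADq^M)(1 - BDq^M)`.
      have split : ∑ p ∈ Finset.HasAntidiagonal.antidiagonal M,
            q ^ p.2 * (qRecip q p.1 * qRecip q p.2 * F (p.1 + 1) p.2)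
          = ∑ p ∈ Finset.HasAntidiagonal.antidiagonal M, q ^ p.2 * (qRecip q p.1 * qRecip q p.2
          * (qShift q A (p.1 + 1) * qShift q B (p.1 + 1) * D ^ (p.1 + 1) * qShift q D p.2
            * (qShift q (A * B * D * q ^ (p.1 + 1)) p.2 - qShift q (A * B * D * q ^ p.1) p.2)))
          + ∑ p ∈ Finset.HasAntidiagonal.antidiagonal M, q ^ p.2 * (qRecip q p.1 * qRecip q p.2
          * (D * (1 - A * q ^ p.1) * (1 - B * q ^ p.1) * F p.1 p.2)) := by
        rw [← Finset.sum_add_distrib]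
        refine Finset.sum_congr rfl fun p _ => ?_
        simp only [hF]
        rw [qShift_succ q A, qShift_succ q B]
        ring
      rw [step1, split, step2, ← Finset.sum_add_distrib, ← Finset.sum_add_distrib, Finset.mul_sum]
      refine Finset.sum_congr rfl fun p hp => ?_
      rw [← Finset.HasAntidiagonal.mem_antidiagonal.mp hp]
      simp only [hF]
      rw [qShift_succ q (A * B * D * q ^ p.1), qShift_succ q D, pow_add]
      ring
    have h2 : (1 - q ^ (M + 1)) ≠ 0 := h1 M
    apply mul_left_cancel₀ h2
    rw [step3, ih, ← hR M, qShift_succ, qShift_succ]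
    ring

/-! ### The finite Bailey lemma at base `1`. -/

/-- The weights `(q/b, q/c)_j (bc/q)_{N-j} (bc/q)^j / (q)_{N-j}` of the finite Bailey lemma. -/
def baileyWeight (q b c : ℂ) (N j : ℕ) : ℂ :=
  qShift q (q / b) j * qShift q (q / c) j * qShift q (b * c / q) (N - j) * (b * c / q) ^ j
    * qRecip q ((N : ℤ) - j)

/-- The coefficients `(q/b, q/c)_i (bc/q)^i / ((b, c)_i (q)_{N-i} (q)_{N+i})`. -/
def baileyCoeff (q b c : ℂ) (N i : ℕ) : ℂ :=
  qShift q (q / b) i * qShift q (q / c) i / (qShift q b i * qShift q c i) * (b * c / q) ^ i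
    * (qRecip q ((N : ℤ) - i) * qRecip q ((N : ℤ) + i))

/-- For `i > N` both sides vanish. Otherwise only `j = i + k` with `0 ≤ k ≤ N - i` contributes, and
the sum over `k` is `qPfaffSaalschutz`. -/
theorem baileyCoeff_mul {q : ℂ} (hq : q ≠ 0) (h1 : ∀ n : ℕ, 1 - q ^ (n + 1) ≠ 0) {b c : ℂ}
    (hb0 : b ≠ 0) (hc0 : c ≠ 0) (hb : ∀ j : ℕ, 1 - b * q ^ j ≠ 0) (hc : ∀ j : ℕ, 1 - c * q ^ j ≠ 0)
    (N i : ℕ) :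
    baileyCoeff q b c N i * (qShift q b N * qShift q c N)
      = ∑ j ∈ Finset.range (N + 1),
          baileyWeight q b c N j * (qRecip q ((j : ℤ) - i) * qRecip q ((j : ℤ) + i)) := by
  rcases lt_or_ge N i with h | h
  · rw [baileyCoeff, qRecip_neg hq (by omega), Finset.sum_eq_zero]
    · ring
    · intro j hj
      have := Finset.mem_range.mp hj
      rw [qRecip_neg hq (k := (j : ℤ) - i) (by omega)]
      ring
  obtain ⟨M, rfl⟩ := Nat.exists_eq_add_of_le h
  -- With these parameters `AD = cq^i` and `BD = bq^i` complete `(c)_i` and `(b)_i` to `(c)_N` and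
  -- `(b)_N`. Since `ABD = q^{2i+1}`, the factor `(ABDq^k)_{M-k}` is the quotient `(q)_{2i+M} /
  -- (q)_{2i+k}`.
  have PS := qPfaffSaalschutz hq h1 (q / b * q ^ i) (q / c * q ^ i) (b * c / q) M
  rw [Finset.Nat.sum_antidiagonal_eq_sum_range_succ_mk] at PS
  have eAD : q / b * q ^ i * (b * c / q) = c * q ^ i := by field_simp
  have eBD : q / c * q ^ i * (b * c / q) = b * q ^ i := by field_simp
  have eABD : q / b * q ^ i * (q / c * q ^ i) * (b * c / q) = q * q ^ (2 * i) := by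
    field_simp; ring
  rw [eAD, eBD, eABD] at PS
  have hPb : qShift q b i ≠ 0 := qShift_ne_zero fun j _ => hb j
  have hPc : qShift q c i ≠ 0 := qShift_ne_zero fun j _ => hc j
  have lhs : baileyCoeff q b c (i + M) i * (qShift q b (i + M) * qShift q c (i + M))
      = qShift q (q / b) i * qShift q (q / c) i * (b * c / q) ^ i * qRecip q ((2 * i + M : ℕ) : ℤ)
        * (qRecip q M * qShift q (c * q ^ i) M * qShift q (b * q ^ i) M) := by
    have e1 : ((i + M : ℕ) : ℤ) - i = (M : ℤ) := by push_cast; ring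
    have e2 : ((i + M : ℕ) : ℤ) + i = ((2 * i + M : ℕ) : ℤ) := by push_cast; ring
    rw [baileyCoeff, e1, e2, qShift_add q b, qShift_add q c]
    field_simp
  rw [lhs, ← PS, Finset.mul_sum, add_assoc, Finset.sum_range_add,
    Finset.sum_eq_zero (s := Finset.range i), zero_add]
  · refine Finset.sum_congr rfl fun k hk => ?_
    have hkM : k ≤ M := Nat.lt_succ_iff.mp (Finset.mem_range.mp hk)
    obtain ⟨t, rfl⟩ := Nat.exists_eq_add_of_le hkM
    have e1 : ((i + (k + t) : ℕ) : ℤ) - ((i + k : ℕ) : ℤ) = (t : ℤ) := by push_cast; ring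
    have e2 : ((i + k : ℕ) : ℤ) - (i : ℤ) = (k : ℤ) := by push_cast; ring
    have e3 : ((i + k : ℕ) : ℤ) + (i : ℤ) = ((2 * i + k : ℕ) : ℤ) := by push_cast; ring
    have e4 : i + (k + t) - (i + k) = t := by omega
    have e5 : k + t - k = t := by omega
    simp only [baileyWeight]
    rw [e1, e2, e3, e4, e5, qShift_add q (q / b), qShift_add q (q / c),
      qRecip_natCast q (2 * i + (k + t)), qRecip_natCast q (2 * i + k),
      ← add_assoc (2 * i), qShift_add q q (2 * i + k) t, pow_add q (2 * i) k, ← mul_assoc q]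
    have n1 : qShift q q (2 * i + k) ≠ 0 := qShift_self_ne_zero h1 _
    have n2 : qShift q (q * q ^ (2 * i) * q ^ k) t ≠ 0 := by
      refine qShift_ne_zero fun j _ => ?_
      have := h1 (2 * i + k + j)
      convert this using 2
      ring
    field_simp
    ring
  · intro j hj
    have := Finset.mem_range.mp hj
    rw [qRecip_neg hq (k := (j : ℤ) - i) (by omega)]
    ring

/-! ### The terminating very-well-poised sum. -/

/-- The factor `(q²/d, q²/e)_i / (d, e)_i (-1)^i q^{i(i-1)/2} (de/q²)^i`. -/
def wellPoisedFactor (q d e : ℂ) (i : ℕ) : ℂ :=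
  qShift q (q ^ 2 / d) i * qShift q (q ^ 2 / e) i / (qShift q d i * qShift q e i)
    * ((∏ j ∈ Finset.range i, (-q ^ j)) * (d * e / q ^ 2) ^ i)

theorem wellPoisedFactor_succ {q d e : ℂ} (hq : q ≠ 0) (hd0 : d ≠ 0) (he0 : e ≠ 0) (i : ℕ)
    (hd : 1 - d * q ^ i ≠ 0) (he : 1 - e * q ^ i ≠ 0) :
    wellPoisedFactor q d e (i + 1) * ((1 - d * q ^ i) * (1 - e * q ^ i))
      = -wellPoisedFactor q d e i * ((d - q ^ 2 * q ^ i) * (e - q ^ 2 * q ^ i) * (q ^ i / q ^ 2)) := by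
  simp only [wellPoisedFactor, qShift_succ, Finset.prod_range_succ, pow_succ _ i]
  rw [mul_comm e] at he
  field_simp

/-- The terminating very-well-poised `₆φ₅` sum at the base parameter `q`. -/
theorem wellPoised_sum {q d e : ℂ} (hq : q ≠ 0) (h1 : ∀ n : ℕ, 1 - q ^ (n + 1) ≠ 0)
    (hd0 : d ≠ 0) (he0 : e ≠ 0) {N : ℕ}
    (hd : ∀ j < N, 1 - d * q ^ j ≠ 0) (he : ∀ j < N, 1 - e * q ^ j ≠ 0) {j : ℕ} (hj : j ≤ N) :
    ∑ i ∈ Finset.range (N + 1), (1 - q ^ (2 * i + 1)) * wellPoisedFactor q d e i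
        * (qRecip q ((j : ℤ) - i) * qRecip q ((j : ℤ) + i + 1))
      = qShift q (d * e / q ^ 2) j / (qShift q q j * qShift q d j * qShift q e j) := by
  induction j with
  | zero =>
    rw [Finset.sum_eq_single 0]
    · have := qRecip_nat_succ hq h1 0
      simp only [zero_add, pow_one, Nat.cast_one, Nat.cast_zero, qRecip_zero] at this
      simp [wellPoisedFactor, this]
    · intro i _ hi
      rw [qRecip_neg hq (k := ((0 : ℕ) : ℤ) - i) (by omega)]
      ring
    · simp
  | succ j ih =>
    have ih := ih (by omega)
    have nd := hd j (by omega)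
    have ne := he j (by omega)
    have nq := h1 j
    set w := wellPoisedFactor q d e
    -- A telescoping certificate: by `key`, the summands for `j + 1` and `j`, multiplied by the
    -- factors of the expected recurrence, differ by `g (i + 1) - g i`. At the ends, `g 0 = 0`
    -- because of `1 - q^0`, and `g (N + 1) = 0` because `1/(q)_{j-N} = 0` for `j < N`.
    set g : ℕ → ℂ := fun i => -w i * (1 - q ^ i) * (1 - d * q ^ i / q) * (1 - e * q ^ i / q)
      * (q * q ^ j / q ^ i) * (qRecip q ((j : ℤ) - i + 1) * qRecip q ((j : ℤ) + i + 1)) with hg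
    have key : ∀ i ∈ Finset.range (N + 1),
        (1 - q ^ (2 * i + 1)) * w i
          * (qRecip q (((j + 1 : ℕ) : ℤ) - i) * qRecip q (((j + 1 : ℕ) : ℤ) + i + 1))
          * ((1 - q ^ (j + 1)) * (1 - d * q ^ j) * (1 - e * q ^ j))
        = (1 - q ^ (2 * i + 1)) * w i * (qRecip q ((j : ℤ) - i) * qRecip q ((j : ℤ) + i + 1))
          * (1 - d * e / q ^ 2 * q ^ j) + (g (i + 1) - g i) := by
      intro i hi
      have hi := Finset.mem_range.mp hi
      have e1 : ((j + 1 : ℕ) : ℤ) - i = (j : ℤ) - i + 1 := by push_cast; ring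
      have e2 : ((j + 1 : ℕ) : ℤ) + i + 1 = (j : ℤ) + i + 2 := by push_cast; ring
      have r1 : qRecip q ((j : ℤ) - i) = (1 - q * q ^ j / q ^ i) * qRecip q ((j : ℤ) - i + 1) := by
        have := qRecip_sub_one hq h1 ((j : ℤ) - i + 1)
        rw [add_sub_cancel_right] at this
        rw [this, zpow_add₀ hq, zpow_sub₀ hq, zpow_natCast, zpow_natCast, zpow_one]
        ring
      have r2 : qRecip q ((j : ℤ) + i + 1)
          = (1 - q ^ 2 * q ^ i * q ^ j) * qRecip q ((j : ℤ) + i + 2) := by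
        have := qRecip_sub_one hq h1 ((j : ℤ) + i + 2)
        rw [show (j : ℤ) + i + 2 - 1 = j + i + 1 by ring] at this
        rw [this, zpow_add₀ hq, zpow_add₀ hq, zpow_natCast, zpow_natCast]
        norm_cast
        ring
      have e3 : (j : ℤ) - ((i + 1 : ℕ) : ℤ) + 1 = j - i := by push_cast; ring
      have e4 : (j : ℤ) + ((i + 1 : ℕ) : ℤ) + 1 = j + i + 2 := by push_cast; ring
      have gs : g (i + 1) = w i * (1 - q * q ^ i) * (d - q ^ 2 * q ^ i) * (e - q ^ 2 * q ^ i)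
          * (q ^ j / q ^ 2) * (qRecip q ((j : ℤ) - i) * qRecip q ((j : ℤ) + i + 2)) := by
        rcases Nat.lt_or_ge i N with hiN | hiN
        · have ws := wellPoisedFactor_succ hq hd0 he0 i (hd i hiN) (he i hiN)
          have d1 : d * q ^ (i + 1) / q = d * q ^ i := by field_simp; ring
          have d2 : e * q ^ (i + 1) / q = e * q ^ i := by field_simp; ring
          simp only [hg]
          rw [e3, e4, d1, d2]
          have hqi : q ^ i ≠ 0 := pow_ne_zero _ hq
          calc _ = -(w (i + 1) * ((1 - d * q ^ i) * (1 - e * q ^ i))) * (1 - q ^ (i + 1))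
                * (q * q ^ j / q ^ (i + 1))
                * (qRecip q ((j : ℤ) - i) * qRecip q ((j : ℤ) + i + 2)) := by ring
            _ = _ := by
              rw [ws]
              field_simp
              ring
        -- For `i = N` the factor `1 - dq^N` may vanish, so the recurrence for `w` is not available;
        -- but `j < N` makes `1/(q)_{j-N}` zero on both sides.
        · simp only [hg]
          rw [e3, qRecip_neg hq (k := (j : ℤ) - i) (by omega)]
          ring
      rw [e1, e2, gs, r1]
      simp only [hg]
      rw [r2]
      have hx : q ^ i ≠ 0 := pow_ne_zero _ hq
      rw [pow_succ q (2 * i), pow_succ q j, mul_comm 2 i, pow_mul]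
      generalize q ^ i = x at *
      generalize q ^ j = y at *
      field_simp
      ring
    have tele : (∑ i ∈ Finset.range (N + 1), (1 - q ^ (2 * i + 1)) * w i
          * (qRecip q (((j + 1 : ℕ) : ℤ) - i) * qRecip q (((j + 1 : ℕ) : ℤ) + i + 1)))
          * ((1 - q ^ (j + 1)) * (1 - d * q ^ j) * (1 - e * q ^ j))
        = (∑ i ∈ Finset.range (N + 1), (1 - q ^ (2 * i + 1)) * w i
            * (qRecip q ((j : ℤ) - i) * qRecip q ((j : ℤ) + i + 1)))
          * (1 - d * e / q ^ 2 * q ^ j) := by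
      rw [Finset.sum_mul, Finset.sum_congr rfl key, Finset.sum_add_distrib, Finset.sum_range_sub,
        ← Finset.sum_mul]
      have g0 : g 0 = 0 := by simp [hg]
      have gN : g (N + 1) = 0 := by
        simp only [hg]
        rw [qRecip_neg hq (k := (j : ℤ) - ((N + 1 : ℕ) : ℤ) + 1) (by push_cast; omega)]
        ring
      rw [g0, gN]
      ring
    rw [ih] at tele
    have p1 : qShift q q j ≠ 0 := qShift_self_ne_zero h1 _
    have p2 : qShift q d j ≠ 0 := qShift_ne_zero fun i hi => hd i (by omega)
    have p3 : qShift q e j ≠ 0 := qShift_ne_zero fun i hi => he i (by omega)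
    rw [← mul_left_inj' (mul_ne_zero (mul_ne_zero nq nd) ne), tele]
    simp only [qShift_succ]
    rw [show 1 - q * q ^ j = 1 - q ^ (j + 1) by ring]
    generalize 1 - q ^ (j + 1) = z1 at *
    generalize 1 - d * q ^ j = z2 at *
    generalize 1 - e * q ^ j = z3 at *
    generalize 1 - d * e / q ^ 2 * q ^ j = z4 at *
    field_simp

/-! ### The bilateral summands in terms of Bailey coefficients. -/

theorem prod_neg_pow_succ (q : ℂ) (i : ℕ) :
    ∏ j ∈ Finset.range (i + 1), (-q ^ j) = (∏ j ∈ Finset.range i, (-q ^ j)) * (-q ^ i) :=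
  Finset.prod_range_succ _ _

/-- Each factor satisfies `q^N - q^j = -q^j (1 - q^{N-j})`. For `i > N` both sides are `0`, so the
termination of the series is carried by `qRecip`. -/
theorem qShift_div_pow {q : ℂ} (hq : q ≠ 0) (h1 : ∀ n : ℕ, 1 - q ^ (n + 1) ≠ 0) (N i : ℕ) :
    qShift q (q / q ^ (N + 1)) i * (q ^ N) ^ i
      = (∏ j ∈ Finset.range i, (-q ^ j)) * (qShift q q N * qRecip q ((N : ℤ) - i)) := by
  induction i with
  | zero =>
    simp [qRecip_natCast, qShift_self_ne_zero h1 N]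
  | succ i ih =>
    have r := qRecip_sub_one hq h1 ((N : ℤ) - i)
    rw [zpow_sub₀ hq, zpow_natCast, zpow_natCast] at r
    rw [qShift_succ, prod_neg_pow_succ,
      show (N : ℤ) - ((i + 1 : ℕ) : ℤ) = N - i - 1 by push_cast; ring, r, pow_succ _ i]
    have e : (1 - q / q ^ (N + 1) * q ^ i) * q ^ N = -q ^ i * (1 - q ^ N / q ^ i) := by
      field_simp; ring
    calc _ = (qShift q (q / q ^ (N + 1)) i * (q ^ N) ^ i)
          * ((1 - q / q ^ (N + 1) * q ^ i) * q ^ N) := by ring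
      _ = _ := by rw [ih, e]; ring

theorem qShift_pow_succ {q : ℂ} (h1 : ∀ n : ℕ, 1 - q ^ (n + 1) ≠ 0) (N i : ℕ) :
    (qShift q (q ^ (N + 1)) i)⁻¹ = qShift q q N * qRecip q ((N : ℤ) + i) := by
  have h := qShift_add q q N i
  rw [← pow_succ'] at h
  rw [← Nat.cast_add, qRecip_natCast, h, mul_inv, mul_inv_cancel_left₀ (qShift_self_ne_zero h1 N)]

theorem pow_succ_shift_ne {q : ℂ} (h1 : ∀ n : ℕ, 1 - q ^ (n + 1) ≠ 0) (N j : ℕ) :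
    1 - q ^ (N + 1) * q ^ j ≠ 0 := by
  have := h1 (N + j)
  rwa [show N + j + 1 = N + 1 + j by ring, pow_add] at this

/-- In the ratio the signs and the quadratic powers of `q` cancel. No factor is assumed nonzero:
where one vanishes, both sides are `0` by the convention for division, as required for the summands
that are cut off. -/
theorem qPoch_neg_div {q x y : ℂ} (hq : q ≠ 0) (hx : x ≠ 0) (hy : y ≠ 0) (k : ℕ) :
    qPoch q x (-(k : ℤ)) / qPoch q y (-(k : ℤ))
      = qShift q (q / y) k / qShift q (q / x) k * (y / x) ^ k := by
  have h : (∏ j ∈ Finset.range k, (-(y / q ^ (j + 1))))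
      = (y / x) ^ k * ∏ j ∈ Finset.range k, (-(x / q ^ (j + 1))) := by
    rw [← Finset.card_range k, ← Finset.prod_const, Finset.card_range, ← Finset.prod_mul_distrib]
    refine Finset.prod_congr rfl fun j _ => ?_
    field_simp
  have h0 : ∏ j ∈ Finset.range k, (-(x / q ^ (j + 1))) ≠ 0 :=
    Finset.prod_ne_zero_iff.mpr fun j _ => neg_ne_zero.mpr (div_ne_zero hx (pow_ne_zero _ hq))
  rw [qPoch_neg hq hx, qPoch_neg hq hy, h, div_eq_mul_inv, inv_inv, mul_inv, div_eq_mul_inv]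
  field_simp

/-- The factor of the bilateral summand that depends on `a, b, c`. -/
theorem bilateral_abc_factor {q : ℂ} (hq : q ≠ 0) (h1 : ∀ n : ℕ, 1 - q ^ (n + 1) ≠ 0) {b c : ℂ}
    (hb0 : b ≠ 0) (hc0 : c ≠ 0) (N i : ℕ) :
    qShift q (q / q ^ (N + 1)) i * qShift q (q / b) i * qShift q (q / c) i
      / (qShift q (q ^ (N + 1)) i * qShift q b i * qShift q c i)
    = qShift q q N ^ 2 * baileyCoeff q b c N i * (∏ j ∈ Finset.range i, (-q ^ j))
      * (q ^ 2 / (q ^ (N + 1) * b * c)) ^ i := by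
  have hA := qShift_div_pow hq h1 N i
  have hB := qShift_pow_succ h1 N i
  have hqN : (q ^ N) ^ i ≠ 0 := pow_ne_zero _ (pow_ne_zero _ hq)
  rw [← eq_div_iff hqN] at hA
  have e : (b * c / q) ^ i * (q ^ 2 / (q ^ (N + 1) * b * c)) ^ i = ((q ^ N) ^ i)⁻¹ := by
    rw [← mul_pow, ← inv_pow]
    congr 1
    field_simp
    ring
  rw [baileyCoeff]
  calc _ = qShift q (q / q ^ (N + 1)) i * (qShift q (q ^ (N + 1)) i)⁻¹ * (qShift q (q / b) i
        * qShift q (q / c) i / (qShift q b i * qShift q c i)) := by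
        simp only [div_eq_mul_inv, mul_inv]; ring
    _ = _ := by
      rw [hA, hB, div_eq_mul_inv, ← e]
      ring

/-- This and `bilateralTerm_neg` justify the pairing of `i + 1` with `-i`: the same
`wellPoisedFactor` at `i` occurs in both, and only the index of `baileyCoeff` and the power of `q`
differ. The minus sign is that of the last factor of `∏ (-q^j)`, `j ≤ i`; those of the `d` and `e`
ratios cancel. -/
theorem bilateralTerm_natCast_succ {q : ℂ} (hq : q ≠ 0) (h1 : ∀ n : ℕ, 1 - q ^ (n + 1) ≠ 0)
    {b c d e : ℂ} (hb0 : b ≠ 0) (hc0 : c ≠ 0) (hd0 : d ≠ 0) (he0 : e ≠ 0) (hdq : d ≠ q)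
    (heq : e ≠ q) (N s i : ℕ) :
    bilateralTerm q (q ^ (N + 1)) b c d e s ((i : ℤ) + 1)
      = -(qShift q q N ^ 2 * baileyCoeff q b c N (i + 1) * wellPoisedFactor q d e i
        * (q ^ i * (q ^ 4 / q ^ s) ^ (i + 1))) := by
  have hab := bilateral_abc_factor hq h1 hb0 hc0 N (i + 1)
  -- Removing the first factor of each product moves the bases `q/x`, `x/q` to `q²/x`, `x`. The
  -- removed factors have quotient `-q/x`, and `x ≠ q` keeps the denominator nonzero.
  have ratio : ∀ x : ℂ, x ≠ 0 → x ≠ q → qShift q (q / x) (i + 1) / qShift q (x / q) (i + 1)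
      = -(q / x) * (qShift q (q ^ 2 / x) i / qShift q x i) := by
    intro x hx hxq
    have n1 : q - x ≠ 0 := sub_ne_zero.mpr hxq.symm
    have n2 : x - q ≠ 0 := sub_ne_zero.mpr hxq
    have : (1 - q / x) / (1 - x / q) = -(q / x) := by
      rw [one_sub_div hx, one_sub_div hq]
      field_simp
      ring
    rw [qShift_succ', qShift_succ', mul_div_mul_comm, this, div_mul_cancel₀ x hq,
      show q / x * q = q ^ 2 / x by ring]
  have hd := ratio d hd0 hdq
  have he := ratio e he0 heq
  have z : (q ^ 2 / (q ^ (N + 1) * b * c)) ^ (i + 1)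
      * (q ^ (N + 1) * b * c * d * e / q ^ s) ^ (i + 1)
      = (d * e / q ^ 2) ^ (i + 1) * (q ^ 4 / q ^ s) ^ (i + 1) := by
    rw [← mul_pow, ← mul_pow]
    congr 1
    field_simp
  rw [bilateralTerm, show (i : ℤ) + 1 = ((i + 1 : ℕ) : ℤ) by push_cast; ring, zpow_natCast]
  simp only [qPochs, List.map_cons, List.map_nil, List.prod_cons, List.prod_nil, mul_one,
    qPoch_natCast]
  calc _ = (qShift q (q / q ^ (N + 1)) (i + 1) * qShift q (q / b) (i + 1)
        * qShift q (q / c) (i + 1)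
        / (qShift q (q ^ (N + 1)) (i + 1) * qShift q b (i + 1) * qShift q c (i + 1)))
        * (qShift q (q / d) (i + 1) / qShift q (d / q) (i + 1))
        * (qShift q (q / e) (i + 1) / qShift q (e / q) (i + 1))
        * (q ^ (N + 1) * b * c * d * e / q ^ s) ^ (i + 1) := by
        simp only [div_eq_mul_inv, mul_inv]; ring
    _ = qShift q q N ^ 2 * baileyCoeff q b c N (i + 1) * (∏ j ∈ Finset.range (i + 1), (-q ^ j))
        * (qShift q (q ^ 2 / d) i / qShift q d i * (qShift q (q ^ 2 / e) i / qShift q e i))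
        * (q / d * (q / e)) * ((q ^ 2 / (q ^ (N + 1) * b * c)) ^ (i + 1)
          * (q ^ (N + 1) * b * c * d * e / q ^ s) ^ (i + 1)) := by
        rw [hab, hd, he]; ring
    _ = _ := by
      have w : q / d * (q / e) * (d * e / q ^ 2) ^ (i + 1) = (d * e / q ^ 2) ^ i := by
        rw [pow_succ]; field_simp
      rw [z, prod_neg_pow_succ, wellPoisedFactor, ← w]
      simp only [div_eq_mul_inv, mul_inv]
      ring

theorem bilateralTerm_neg {q : ℂ} (hq : q ≠ 0) (h1 : ∀ n : ℕ, 1 - q ^ (n + 1) ≠ 0)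
    {b c d e : ℂ} (hb0 : b ≠ 0) (hc0 : c ≠ 0) (hd0 : d ≠ 0) (he0 : e ≠ 0) (N s i : ℕ) :
    bilateralTerm q (q ^ (N + 1)) b c d e s (-(i : ℤ))
      = qShift q q N ^ 2 * baileyCoeff q b c N i * wellPoisedFactor q d e i
        * (q ^ s / q ^ 3) ^ i := by
  have hab := bilateral_abc_factor hq h1 hb0 hc0 N i
  have sym : ∀ x : ℂ, x ≠ 0 → qPoch q (q / x) (-(i : ℤ)) / qPoch q x (-(i : ℤ))
      = qShift q (q / x) i / qShift q x i * (x ^ 2 / q) ^ i := by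
    intro x hx
    rw [qPoch_neg_div hq (div_ne_zero hq hx) hx, div_div_cancel₀ hq]
    congr 2
    field_simp
  have asym : ∀ x : ℂ, x ≠ 0 → qPoch q (q / x) (-(i : ℤ)) / qPoch q (x / q) (-(i : ℤ))
      = qShift q (q ^ 2 / x) i / qShift q x i * (x ^ 2 / q ^ 2) ^ i := by
    intro x hx
    rw [qPoch_neg_div hq (div_ne_zero hq hx) (div_ne_zero hx hq), div_div_cancel₀ hq,
      show q / (x / q) = q ^ 2 / x by field_simp, show x / q / (q / x) = x ^ 2 / q ^ 2 by field_simp]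
  have ha0 : q ^ (N + 1) ≠ 0 := pow_ne_zero _ hq
  have z : (q ^ 2 / (q ^ (N + 1) * b * c)) ^ i * (((q ^ (N + 1)) ^ 2 / q) ^ i * (b ^ 2 / q) ^ i
      * (c ^ 2 / q) ^ i * (d ^ 2 / q ^ 2) ^ i * (e ^ 2 / q ^ 2) ^ i)
      * ((q ^ (N + 1) * b * c * d * e / q ^ s) ^ i)⁻¹
      = (d * e / q ^ 2) ^ i * (q ^ s / q ^ 3) ^ i := by
    simp only [← mul_pow, ← inv_pow]
    congr 1
    generalize q ^ (N + 1) = a at *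
    field_simp
  rw [bilateralTerm, zpow_neg, zpow_natCast]
  simp only [qPochs, List.map_cons, List.map_nil, List.prod_cons, List.prod_nil, mul_one]
  calc _ = (qPoch q (q / q ^ (N + 1)) (-(i : ℤ)) / qPoch q (q ^ (N + 1)) (-(i : ℤ)))
        * (qPoch q (q / b) (-(i : ℤ)) / qPoch q b (-(i : ℤ)))
        * (qPoch q (q / c) (-(i : ℤ)) / qPoch q c (-(i : ℤ)))
        * (qPoch q (q / d) (-(i : ℤ)) / qPoch q (d / q) (-(i : ℤ)))
        * (qPoch q (q / e) (-(i : ℤ)) / qPoch q (e / q) (-(i : ℤ)))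
        * ((q ^ (N + 1) * b * c * d * e / q ^ s) ^ i)⁻¹ := by
        simp only [div_eq_mul_inv, mul_inv]; ring
    _ = (qShift q (q / q ^ (N + 1)) i * qShift q (q / b) i * qShift q (q / c) i
        / (qShift q (q ^ (N + 1)) i * qShift q b i * qShift q c i))
        * (qShift q (q ^ 2 / d) i / qShift q d i * (qShift q (q ^ 2 / e) i / qShift q e i))
        * (((q ^ (N + 1)) ^ 2 / q) ^ i * (b ^ 2 / q) ^ i
          * (c ^ 2 / q) ^ i * (d ^ 2 / q ^ 2) ^ i * (e ^ 2 / q ^ 2) ^ i)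
        * ((q ^ (N + 1) * b * c * d * e / q ^ s) ^ i)⁻¹ := by
        rw [sym _ ha0, sym b hb0, sym c hc0, asym d hd0, asym e he0]
        simp only [div_eq_mul_inv, mul_inv]; ring
    _ = qShift q q N ^ 2 * baileyCoeff q b c N i * (∏ j ∈ Finset.range i, (-q ^ j))
        * (qShift q (q ^ 2 / d) i / qShift q d i * (qShift q (q ^ 2 / e) i / qShift q e i))
        * ((q ^ 2 / (q ^ (N + 1) * b * c)) ^ i * (((q ^ (N + 1)) ^ 2 / q) ^ i * (b ^ 2 / q) ^ i
          * (c ^ 2 / q) ^ i * (d ^ 2 / q ^ 2) ^ i * (e ^ 2 / q ^ 2) ^ i)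
        * ((q ^ (N + 1) * b * c * d * e / q ^ s) ^ i)⁻¹) := by
        rw [hab]; ring
    _ = _ := by
      rw [z, wellPoisedFactor]
      simp only [div_eq_mul_inv, mul_inv]
      ring

theorem baileyCoeff_eq_zero {q : ℂ} (hq : q ≠ 0) (b c : ℂ) {N i : ℕ} (h : N < i) :
    baileyCoeff q b c N i = 0 := by
  rw [baileyCoeff, qRecip_neg hq (by omega)]; ring

theorem hasSum_int_of_fold {f : ℤ → ℂ} (N : ℕ) (hpos : ∀ i : ℕ, N ≤ i → f ((i : ℤ) + 1) = 0)
    (hneg : ∀ i : ℕ, N < i → f (-(i : ℤ)) = 0) :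
    HasSum f (∑ i ∈ Finset.range (N + 1), (f (-(i : ℤ)) + f ((i : ℤ) + 1))) := by
  -- After negation, the standard splitting of `ℤ` into `i` and `-(i + 1)` becomes the splitting
  -- into `-i` and `i + 1`.
  rw [← (Equiv.neg ℤ).hasSum_iff, Finset.sum_add_distrib]
  refine HasSum.of_nat_of_neg_add_one ?_ ?_
  · refine hasSum_sum_of_ne_finset_zero fun i hi => hneg i ?_
    rw [Finset.mem_range] at hi
    omega
  · have := hasSum_sum_of_ne_finset_zero (f := fun i : ℕ => f ((i : ℤ) + 1))
      (s := Finset.range (N + 1)) (L := .unconditional ℕ) fun i hi => hpos i (by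
        rw [Finset.mem_range] at hi
        omega)
    simpa using this

/-! ### The prefactor and the unilateral summands for `a = q^(N+1)`. -/

theorem qPochInf_eq_mul {q : ℂ} (hq : ‖q‖ < 1) (x : ℂ) (N : ℕ) :
    qPochInf q x = qShift q x N * qPochInf q (x * q ^ N) := by
  have h := (tendsto_qPoch hq x).comp (Filter.tendsto_add_atTop_nat N)
  have h' := (tendsto_qPoch hq (x * q ^ N)).const_mul (qShift q x N)
  refine tendsto_nhds_unique h (h'.congr fun n => ?_)
  simp only [Function.comp_apply, qPoch_natCast]
  rw [add_comm n N, qShift_add]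

theorem qPochInf_ne_zero {q x : ℂ} (hq : ‖q‖ < 1) (h : ∀ j : ℕ, 1 - x * q ^ j ≠ 0) :
    qPochInf q x ≠ 0 := by
  have hs : Summable fun j : ℕ => ‖-(x * q ^ j)‖ := by
    simp only [norm_neg, norm_mul, norm_pow]
    exact (summable_geometric_of_lt_one (norm_nonneg q) hq).mul_left _
  have := tprod_one_add_ne_zero_of_summable (f := fun j : ℕ => -(x * q ^ j))
    (fun j => by simpa [sub_eq_add_neg] using h j) hs
  simpa [qPochInf, sub_eq_add_neg] using this

theorem shift_ne {q x : ℂ} (h : ∀ j : ℕ, 1 - x * q ^ j ≠ 0) (N j : ℕ) :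
    1 - x * q ^ N * q ^ j ≠ 0 := by
  rw [mul_assoc, ← pow_add]; exact h _

/-- Since `ab/q = bq^N`, `ac/q = cq^N` and `abc/q² = (bc/q)q^N`, the infinite products have common
tails, which cancel and leave products of length `N`. -/
theorem prefactor_pow_succ {q : ℂ} (hq : q ≠ 0) (hq1 : ‖q‖ < 1) {b c : ℂ}
    (h1 : ∀ n : ℕ, 1 - q ^ (n + 1) ≠ 0)
    (hb : ∀ j : ℕ, 1 - b * q ^ j ≠ 0) (hc : ∀ j : ℕ, 1 - c * q ^ j ≠ 0) (N : ℕ)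
    (habc : ∀ j : ℕ, 1 - q ^ (N + 1) * b * c / q ^ 2 * q ^ j ≠ 0) :
    prefactor q (q ^ (N + 1)) b c
      = qShift q q N * qShift q (b * c / q) N / (qShift q b N * qShift q c N) := by
  have e1 : q ^ (N + 1) * b / q = b * q ^ N := by field_simp; ring
  have e2 : q ^ (N + 1) * c / q = c * q ^ N := by field_simp; ring
  have e3 : b * c / q * q ^ N = q ^ (N + 1) * b * c / q ^ 2 := by field_simp; ring
  have n1 := qPochInf_ne_zero hq1 (pow_succ_shift_ne h1 N)
  have n2 := qPochInf_ne_zero hq1 (shift_ne hb N)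
  have n3 := qPochInf_ne_zero hq1 (shift_ne hc N)
  have n4 := qPochInf_ne_zero hq1 habc
  have m2 : qShift q b N ≠ 0 := qShift_ne_zero fun j _ => hb j
  have m3 : qShift q c N ≠ 0 := qShift_ne_zero fun j _ => hc j
  simp only [prefactor, qPochsInf, List.map_cons, List.map_nil, List.prod_cons, List.prod_nil,
    mul_one]
  rw [e1, e2, qPochInf_eq_mul hq1 q N, qPochInf_eq_mul hq1 (b * c / q) N, e3,
    qPochInf_eq_mul hq1 b N, qPochInf_eq_mul hq1 c N, ← pow_succ']
  generalize qPochInf q (q ^ (N + 1)) = z1 at *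
  generalize qPochInf q (b * q ^ N) = z2 at *
  generalize qPochInf q (c * q ^ N) = z3 at *
  generalize qPochInf q (q ^ (N + 1) * b * c / q ^ 2) = z4 at *
  field_simp

/-- Reversing the last `j` factors of both `(q)_{M+j}` and `(y)_{M+j}` produces powers that differ
only by `(q/y)^j`. With `y = bc/q` this turns `(bc/q)_{N-j} / (q)_{N-j}` from the Bailey weights
into the ratio of `(q^{-N})_j` to `(q³/abc)_j`. -/
theorem qShift_reverse_ratio {q y : ℂ} (hq : q ≠ 0) (h1 : ∀ n : ℕ, 1 - q ^ (n + 1) ≠ 0)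
    (hy : y ≠ 0) (M j : ℕ) :
    qShift q q (M + j) * qRecip q M * qShift q y M * y ^ j
        * qShift q (q ^ (1 - ((M + j : ℕ) : ℤ)) / y) j
      = qShift q (q ^ (1 - ((M + j : ℕ) : ℤ)) / q) j * q ^ j * qShift q y (M + j) := by
  have hM := qShift_self_ne_zero h1 M
  have p : y ^ j * ∏ i ∈ Finset.range j, (-(q * q ^ (((M + j : ℕ) : ℤ) - 1 - (i : ℤ))))
      = q ^ j * ∏ i ∈ Finset.range j, (-(y * q ^ (((M + j : ℕ) : ℤ) - 1 - (i : ℤ)))) := by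
    rw [← Finset.card_range j, ← Finset.prod_const, ← Finset.prod_const, Finset.card_range,
      ← Finset.prod_mul_distrib, ← Finset.prod_mul_distrib]
    exact Finset.prod_congr rfl fun i _ => by ring
  rw [qShift_reverse hq hq M j, qShift_reverse hq hy M j, qRecip_natCast]
  field_simp
  linear_combination (qShift q y M * qShift q (q ^ (1 - ((M + j : ℕ) : ℤ)) / y) j
    * qShift q (q ^ (1 - ((M + j : ℕ) : ℤ)) / q) j) * p

theorem unilateralTerm_eq_zero {q : ℂ} (hq : q ≠ 0) (h1 : ∀ n : ℕ, 1 - q ^ (n + 1) ≠ 0)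
    (b c d e : ℂ) (t : ℕ) {N j : ℕ} (h : N < j) :
    unilateralTerm q (q ^ (N + 1)) b c d e t j = 0 := by
  have := qShift_div_pow hq h1 N j
  rw [qRecip_neg hq (k := (N : ℤ) - j) (by omega), mul_zero, mul_zero,
    mul_eq_zero, or_iff_left (pow_ne_zero _ (pow_ne_zero _ hq))] at this
  simp [unilateralTerm, qPochs, qPoch_natCast, this]

theorem unilateralTerm_eq {q : ℂ} (hq : q ≠ 0) (h1 : ∀ n : ℕ, 1 - q ^ (n + 1) ≠ 0)
    {b c : ℂ} (hb0 : b ≠ 0) (hc0 : c ≠ 0) (d e : ℂ) (r : ℕ) {N j : ℕ} (h : j ≤ N)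
    (habc : ∀ j < N, 1 - q ^ 3 / (q ^ (N + 1) * b * c) * q ^ j ≠ 0) :
    qShift q q N * qShift q (b * c / q) N * unilateralTerm q (q ^ (N + 1)) b c d e (r + 1) j
      = qShift q q N ^ 2 * (baileyWeight q b c N j * (q ^ (r * j) * (qShift q (d * e / q ^ 2) j
          / (qShift q q j * qShift q d j * qShift q e j)))) := by
  obtain ⟨M, rfl⟩ := Nat.exists_eq_add_of_le' h
  have R := qShift_reverse_ratio hq h1 (div_ne_zero (mul_ne_zero hb0 hc0) hq) M j
  have e1 : q ^ (1 - ((M + j : ℕ) : ℤ)) / (b * c / q) = q ^ 3 / (q ^ (M + j + 1) * b * c) := by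
    rw [zpow_sub₀ hq, zpow_natCast, zpow_one]
    field_simp
    ring
  have e2 : q ^ (1 - ((M + j : ℕ) : ℤ)) / q = q / q ^ (M + j + 1) := by
    rw [zpow_sub₀ hq, zpow_natCast, zpow_one]
    field_simp
    ring
  rw [e1, e2] at R
  have n1 : qShift q (q ^ 3 / (q ^ (M + j + 1) * b * c)) j ≠ 0 :=
    qShift_ne_zero fun i hi => habc i (by omega)
  have R' := eq_div_of_mul_eq n1 R
  have e3 : ((M + j : ℕ) : ℤ) - (j : ℤ) = M := by push_cast; ring
  simp only [unilateralTerm, qPochs, List.map_cons, List.map_nil, List.prod_cons, List.prod_nil,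
    mul_one, qPoch_natCast, baileyWeight]
  rw [e3, Nat.add_sub_cancel]
  calc _ = qShift q q (M + j) * (qShift q (q / q ^ (M + j + 1)) j * q ^ j
        * qShift q (b * c / q) (M + j) / qShift q (q ^ 3 / (q ^ (M + j + 1) * b * c)) j)
        * (qShift q (q / b) j * qShift q (q / c) j * (q ^ (r * j) * (qShift q (d * e / q ^ 2) j
          / (qShift q q j * qShift q d j * qShift q e j)))) := by
        rw [add_mul, pow_add, one_mul]
        simp only [div_eq_mul_inv, mul_inv]
        ring
    _ = _ := by
        rw [← R']
        ring

/-! ### Folding and interchange of sums. -/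

/-- The bilateral summands paired by `k ↔ 1 - k` are a combination of two Bailey coefficients;
`r = 0, 1` correspond to the two transformations. -/
theorem folded_sum {q : ℂ} (hq : q ≠ 0) (h1 : ∀ n : ℕ, 1 - q ^ (n + 1) ≠ 0)
    {b c d e : ℂ} (hb0 : b ≠ 0) (hc0 : c ≠ 0) (hd0 : d ≠ 0) (he0 : e ≠ 0)
    (hb : ∀ j : ℕ, 1 - b * q ^ j ≠ 0) (hc : ∀ j : ℕ, 1 - c * q ^ j ≠ 0) {N : ℕ}
    (hd : ∀ j < N, 1 - d * q ^ j ≠ 0) (he : ∀ j < N, 1 - e * q ^ j ≠ 0)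
    (u v : ℕ → ℂ) (r : ℕ)
    (huv : ∀ i j : ℕ, u i * (qRecip q ((j : ℤ) - i) * qRecip q ((j : ℤ) + i))
      - v i * (qRecip q ((j : ℤ) - (i + 1 : ℕ)) * qRecip q ((j : ℤ) + (i + 1 : ℕ)))
      = q ^ (r * j) * ((1 - q ^ (2 * i + 1)) * (qRecip q ((j : ℤ) - i)
        * qRecip q ((j : ℤ) + i + 1)))) :
    (∑ i ∈ Finset.range (N + 1), wellPoisedFactor q d e i
        * (u i * baileyCoeff q b c N i - v i * baileyCoeff q b c N (i + 1)))
        * (qShift q b N * qShift q c N)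
      = ∑ j ∈ Finset.range (N + 1), baileyWeight q b c N j * (q ^ (r * j)
        * (qShift q (d * e / q ^ 2) j / (qShift q q j * qShift q d j * qShift q e j))) := by
  have B := baileyCoeff_mul hq h1 hb0 hc0 hb hc N
  calc _ = ∑ i ∈ Finset.range (N + 1), ∑ j ∈ Finset.range (N + 1),
        baileyWeight q b c N j * q ^ (r * j) * ((1 - q ^ (2 * i + 1)) * wellPoisedFactor q d e i
          * (qRecip q ((j : ℤ) - i) * qRecip q ((j : ℤ) + i + 1))) := by
        rw [Finset.sum_mul]
        refine Finset.sum_congr rfl fun i _ => ?_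
        calc _ = wellPoisedFactor q d e i
            * (u i * (baileyCoeff q b c N i * (qShift q b N * qShift q c N))
              - v i * (baileyCoeff q b c N (i + 1) * (qShift q b N * qShift q c N))) := by ring
          _ = _ := by
            rw [B, B, Finset.mul_sum, Finset.mul_sum, ← Finset.sum_sub_distrib, Finset.mul_sum]
            refine Finset.sum_congr rfl fun j _ => ?_
            linear_combination (wellPoisedFactor q d e i * baileyWeight q b c N j) * huv i j
    _ = _ := by
        -- For fixed `j ≤ N` the inner sum over `i` is now exactly `wellPoised_sum`.
        rw [Finset.sum_comm]
        refine Finset.sum_congr rfl fun j hj => ?_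
        rw [← Finset.mul_sum, wellPoised_sum hq h1 hd0 he0 hd he
          (Nat.lt_succ_iff.mp (Finset.mem_range.mp hj))]
        ring

theorem bilateral_transformation_aux {q : ℂ} (hq : q ≠ 0) (hq1 : ‖q‖ < 1)
    (h1 : ∀ n : ℕ, 1 - q ^ (n + 1) ≠ 0)
    {b c d e : ℂ} (hb0 : b ≠ 0) (hc0 : c ≠ 0) (hd0 : d ≠ 0) (he0 : e ≠ 0)
    (hb : ∀ j : ℕ, 1 - b * q ^ j ≠ 0) (hc : ∀ j : ℕ, 1 - c * q ^ j ≠ 0) {N : ℕ}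
    (habc : ∀ j : ℕ, 1 - q ^ (N + 1) * b * c / q ^ 2 * q ^ j ≠ 0)
    (habc' : ∀ j < N, 1 - q ^ 3 / (q ^ (N + 1) * b * c) * q ^ j ≠ 0)
    (hd : ∀ j < N, 1 - d * q ^ j ≠ 0) (he : ∀ j < N, 1 - e * q ^ j ≠ 0) (hdq : d ≠ q) (heq : e ≠ q)
    (s r : ℕ) (hs : s = r + 3)
    (huv : ∀ i j : ℕ, q ^ (r * i) * (qRecip q ((j : ℤ) - i) * qRecip q ((j : ℤ) + i))
      - q ^ i * (q ^ 4 / q ^ s) ^ (i + 1)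
        * (qRecip q ((j : ℤ) - (i + 1 : ℕ)) * qRecip q ((j : ℤ) + (i + 1 : ℕ)))
      = q ^ (r * j) * ((1 - q ^ (2 * i + 1)) * (qRecip q ((j : ℤ) - i)
        * qRecip q ((j : ℤ) + i + 1)))) :
    Summable (bilateralTerm q (q ^ (N + 1)) b c d e s)
      ∧ Summable (unilateralTerm q (q ^ (N + 1)) b c d e (r + 1))
      ∧ ∑' k : ℤ, bilateralTerm q (q ^ (N + 1)) b c d e s k
        = prefactor q (q ^ (N + 1)) b c * ∑' k : ℕ, unilateralTerm q (q ^ (N + 1)) b c d e (r + 1) k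
      := by
  have hpos := bilateralTerm_natCast_succ hq h1 hb0 hc0 hd0 he0 hdq heq N s
  have hneg := bilateralTerm_neg hq h1 hb0 hc0 hd0 he0 N s
  have L := hasSum_int_of_fold (f := bilateralTerm q (q ^ (N + 1)) b c d e s) N
    (fun i hi => by rw [hpos, baileyCoeff_eq_zero hq b c (by omega)]; ring)
    (fun i hi => by rw [hneg, baileyCoeff_eq_zero hq b c hi]; ring)
  have R : HasSum (unilateralTerm q (q ^ (N + 1)) b c d e (r + 1)) _ :=
    hasSum_sum_of_ne_finset_zero (s := Finset.range (N + 1)) fun j hj =>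
      unilateralTerm_eq_zero hq h1 b c d e (r + 1) (by
        rw [Finset.mem_range] at hj
        omega)
  refine ⟨L.summable, R.summable, ?_⟩
  have m2 : qShift q b N ≠ 0 := qShift_ne_zero fun j _ => hb j
  have m3 : qShift q c N ≠ 0 := qShift_ne_zero fun j _ => hc j
  have F := folded_sum hq h1 hb0 hc0 hd0 he0 hb hc hd he _ _ r huv
  rw [L.tsum_eq, R.tsum_eq, prefactor_pow_succ hq hq1 h1 hb hc N habc, div_mul_eq_mul_div,
    eq_div_iff (mul_ne_zero m2 m3)]
  calc _ = qShift q q N ^ 2 * ((∑ i ∈ Finset.range (N + 1), wellPoisedFactor q d e i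
        * (q ^ (r * i) * baileyCoeff q b c N i
          - q ^ i * (q ^ 4 / q ^ s) ^ (i + 1) * baileyCoeff q b c N (i + 1)))
        * (qShift q b N * qShift q c N)) := by
        rw [← mul_assoc (qShift q q N ^ 2), Finset.mul_sum]
        congr 1
        refine Finset.sum_congr rfl fun i _ => ?_
        have e : q ^ s / q ^ 3 = q ^ r := by rw [hs, pow_add]; field_simp
        rw [hpos, hneg, e, ← pow_mul]
        ring
    _ = _ := by
        rw [F, Finset.mul_sum, Finset.mul_sum]
        refine Finset.sum_congr rfl fun j hj => ?_
        rw [unilateralTerm_eq hq h1 hb0 hc0 d e r (Nat.lt_succ_iff.mp (Finset.mem_range.mp hj)) habc']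

/-- Over the common factor `1/((q)_{j-i} (q)_{j+i+1})` the change of base from `1` to `q` becomes an
elementary identity in powers of `q`. -/
theorem qRecip_combination {q : ℂ} (hq : q ≠ 0) (h1 : ∀ n : ℕ, 1 - q ^ (n + 1) ≠ 0) (i j : ℕ)
    (u v w : ℂ) (h : u * (1 - q * q ^ j * q ^ i) - v * (1 - q ^ j / q ^ i) = w) :
    u * (qRecip q ((j : ℤ) - i) * qRecip q ((j : ℤ) + i))
      - v * (qRecip q ((j : ℤ) - (i + 1 : ℕ)) * qRecip q ((j : ℤ) + (i + 1 : ℕ)))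
      = w * (qRecip q ((j : ℤ) - i) * qRecip q ((j : ℤ) + i + 1)) := by
  have r1 := qRecip_sub_one hq h1 ((j : ℤ) - i)
  have r2 := qRecip_sub_one hq h1 ((j : ℤ) + i + 1)
  rw [zpow_sub₀ hq, zpow_natCast, zpow_natCast] at r1
  rw [add_sub_cancel_right, zpow_add₀ hq, zpow_add₀ hq, zpow_natCast, zpow_natCast, zpow_one] at r2
  rw [show (j : ℤ) - ((i + 1 : ℕ) : ℤ) = j - i - 1 by push_cast; ring,
    show (j : ℤ) + ((i + 1 : ℕ) : ℤ) = j + i + 1 by push_cast; ring, r1, r2, ← h]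
  ring

/-- Both bilateral transformations in the case `a = q^(N+1)`. -/
theorem bilateral_transformation {q : ℂ} (hq : q ≠ 0) (hq1 : ‖q‖ < 1)
    (h1 : ∀ n : ℕ, 1 - q ^ (n + 1) ≠ 0)
    {b c d e : ℂ} (hb0 : b ≠ 0) (hc0 : c ≠ 0) (hd0 : d ≠ 0) (he0 : e ≠ 0)
    (hb : ∀ j : ℕ, 1 - b * q ^ j ≠ 0) (hc : ∀ j : ℕ, 1 - c * q ^ j ≠ 0) {N : ℕ}
    (habc : ∀ j : ℕ, 1 - q ^ (N + 1) * b * c / q ^ 2 * q ^ j ≠ 0)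
    (habc' : ∀ j < N, 1 - q ^ 3 / (q ^ (N + 1) * b * c) * q ^ j ≠ 0)
    (hd : ∀ j < N, 1 - d * q ^ j ≠ 0) (he : ∀ j < N, 1 - e * q ^ j ≠ 0)
    (hdq : d ≠ q) (heq : e ≠ q) :
    (Summable (bilateralTerm q (q ^ (N + 1)) b c d e 3)
      ∧ Summable (unilateralTerm q (q ^ (N + 1)) b c d e 1)
      ∧ ∑' k : ℤ, bilateralTerm q (q ^ (N + 1)) b c d e 3 k
        = prefactor q (q ^ (N + 1)) b c * ∑' k : ℕ, unilateralTerm q (q ^ (N + 1)) b c d e 1 k)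
    ∧ (Summable (bilateralTerm q (q ^ (N + 1)) b c d e 4)
      ∧ Summable (unilateralTerm q (q ^ (N + 1)) b c d e 2)
      ∧ ∑' k : ℤ, bilateralTerm q (q ^ (N + 1)) b c d e 4 k
        = prefactor q (q ^ (N + 1)) b c * ∑' k : ℕ, unilateralTerm q (q ^ (N + 1)) b c d e 2 k) := by
  constructor
  -- Here `u_i = 1` and `v_i = q^{2i+1}`: the terms in `q^{i+j+1}` cancel and `1 - q^{2i+1}`
  -- remains.
  · refine bilateral_transformation_aux hq hq1 h1 hb0 hc0 hd0 he0 hb hc habc habc' hd he hdq heq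
      3 0 rfl fun i j => ?_
    have hqi : q ^ i ≠ 0 := pow_ne_zero _ hq
    rw [← mul_assoc (q ^ (0 * j))]
    refine qRecip_combination hq h1 i j _ _ _ ?_
    have e : q ^ 4 / q ^ 3 = q := by field_simp
    rw [e, zero_mul, zero_mul, pow_zero, pow_succ q (2 * i), mul_comm 2 i, pow_mul, pow_succ q i]
    field_simp
    ring
  -- Here `u_i = v_i = q^i`: the constant terms cancel and `q^j (1 - q^{2i+1})` remains.
  · refine bilateral_transformation_aux hq hq1 h1 hb0 hc0 hd0 he0 hb hc habc habc' hd he hdq heq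
      4 1 rfl fun i j => ?_
    have hqi : q ^ i ≠ 0 := pow_ne_zero _ hq
    rw [← mul_assoc (q ^ (1 * j))]
    refine qRecip_combination hq h1 i j _ _ _ ?_
    have e : q ^ 4 / q ^ 4 = 1 := div_self (pow_ne_zero _ hq)
    rw [e, one_mul, one_mul, one_pow, pow_succ q (2 * i), mul_comm 2 i, pow_mul]
    field_simp
    ring

/-! ### Nonvanishing conditions and the symmetry in `a`, `b`, `c`. -/

theorem one_sub_pow_succ_ne_zero {q : ℂ} (hq1 : ‖q‖ < 1) (n : ℕ) : 1 - q ^ (n + 1) ≠ 0 := by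
  intro h
  have h' : q ^ (n + 1) = 1 := (sub_eq_zero.mp h).symm
  have := pow_lt_one₀ (norm_nonneg q) hq1 (Nat.succ_ne_zero n)
  rw [← norm_pow, Nat.succ_eq_add_one, h', norm_one] at this
  exact lt_irrefl _ this

theorem one_sub_mul_pow_ne_zero {q x : ℂ} (j : ℕ) (h : x ≠ q ^ (-(j : ℤ))) :
    1 - x * q ^ j ≠ 0 := by
  intro h0
  apply h
  rw [zpow_neg, zpow_natCast]
  exact eq_inv_of_mul_eq_one_left (sub_eq_zero.mp h0).symm

theorem bilateralTerm_swap (q a b c d e : ℂ) (s : ℕ) :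
    bilateralTerm q a b c d e s = bilateralTerm q b a c d e s := by
  funext k
  simp only [bilateralTerm, qPochs, List.map_cons, List.map_nil, List.prod_cons, List.prod_nil]
  rw [mul_comm a b, mul_left_comm (qPoch q (q / a) k), mul_left_comm (qPoch q a k)]

theorem bilateralTerm_rotate (q a b c d e : ℂ) (s : ℕ) :
    bilateralTerm q a b c d e s = bilateralTerm q c a b d e s := by
  funext k
  simp only [bilateralTerm, qPochs, List.map_cons, List.map_nil, List.prod_cons, List.prod_nil]
  rw [show a * b * c * d * e = c * a * b * d * e by ring]
  congr 1
  congr 1 <;> ring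

theorem unilateralTerm_swap (q a b c d e : ℂ) (t : ℕ) :
    unilateralTerm q a b c d e t = unilateralTerm q b a c d e t := by
  funext k
  simp only [unilateralTerm, qPochs, List.map_cons, List.map_nil, List.prod_cons, List.prod_nil]
  rw [mul_comm a b, mul_left_comm (qPoch q (q / a) k)]

theorem unilateralTerm_rotate (q a b c d e : ℂ) (t : ℕ) :
    unilateralTerm q a b c d e t = unilateralTerm q c a b d e t := by
  funext k
  simp only [unilateralTerm, qPochs, List.map_cons, List.map_nil, List.prod_cons, List.prod_nil]
  rw [show a * b * c = c * a * b by ring]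
  congr 1
  congr 1
  ring

theorem prefactor_swap (q a b c : ℂ) : prefactor q a b c = prefactor q b a c := by
  simp only [prefactor, qPochsInf, List.map_cons, List.map_nil, List.prod_cons, List.prod_nil]
  rw [mul_comm a b]
  congr 1 <;> ring

theorem prefactor_rotate (q a b c : ℂ) : prefactor q a b c = prefactor q c a b := by
  simp only [prefactor, qPochsInf, List.map_cons, List.map_nil, List.prod_cons, List.prod_nil]
  rw [show a * b * c = c * a * b by ring, mul_comm a c, mul_comm b c]
  congr 1 <;> ring

theorem bilateral_transformation_of_eq_pow {q : ℂ} (hq : q ≠ 0) (hq1 : ‖q‖ < 1)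
    {a b c d e : ℂ} {n : ℕ} (hn : 1 ≤ n) (ha : a = q ^ n)
    (hb0 : b ≠ 0) (hc0 : c ≠ 0) (hd0 : d ≠ 0) (he0 : e ≠ 0)
    (hbc : ∀ i : ℤ, i ≤ 0 → b ≠ q ^ i ∧ c ≠ q ^ i)
    (habc : ∀ i : ℤ, i ≤ (n : ℤ) + 1 → a * b * c ≠ q ^ i)
    (hde : ∀ i : ℤ, 2 - (n : ℤ) ≤ i → i ≤ 1 → d ≠ q ^ i ∧ e ≠ q ^ i) :
    (Summable (bilateralTerm q a b c d e 3) ∧ Summable (unilateralTerm q a b c d e 1) ∧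
        ∑' k : ℤ, bilateralTerm q a b c d e 3 k
          = prefactor q a b c * ∑' k : ℕ, unilateralTerm q a b c d e 1 k) ∧
      (Summable (bilateralTerm q a b c d e 4) ∧ Summable (unilateralTerm q a b c d e 2) ∧
        ∑' k : ℤ, bilateralTerm q a b c d e 4 k
          = prefactor q a b c * ∑' k : ℕ, unilateralTerm q a b c d e 2 k) := by
  obtain ⟨N, rfl⟩ := Nat.exists_eq_add_of_le' hn
  subst ha
  have hP : q ^ (N + 1) * b * c ≠ 0 := mul_ne_zero (mul_ne_zero (pow_ne_zero _ hq) hb0) hc0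
  refine bilateral_transformation hq hq1 (one_sub_pow_succ_ne_zero hq1) hb0 hc0 hd0 he0
    (fun j => one_sub_mul_pow_ne_zero j (hbc _ (by omega)).1)
    (fun j => one_sub_mul_pow_ne_zero j (hbc _ (by omega)).2)
    -- The condition on `abc` serves two denominators: exponents `2 - j ≤ 2` for `(abc/q²)_∞`, and
    -- exponents `3 + j ≤ n + 1` with `j < N` for `(q³/abc)_k`, `k ≤ N`.
    (fun j => one_sub_mul_pow_ne_zero j fun h => habc (2 - j) (by push_cast; omega) ?_)
    (fun j hj h => habc (3 + j) (by push_cast; omega) ?_)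
    (fun j hj => one_sub_mul_pow_ne_zero j (hde _ (by push_cast; omega) (by omega)).1)
    (fun j hj => one_sub_mul_pow_ne_zero j (hde _ (by push_cast; omega) (by omega)).2)
    (by simpa using (hde 1 (by push_cast; omega) le_rfl).1)
    (by simpa using (hde 1 (by push_cast; omega) le_rfl).2)
  · rw [div_eq_iff (pow_ne_zero 2 hq)] at h
    rw [h, ← zpow_natCast q 2, ← zpow_add₀ hq]
    congr 1
    push_cast
    ring
  · have h' := sub_eq_zero.mp h
    rw [div_mul_eq_mul_div, eq_div_iff hP, one_mul] at h'
    rw [h', zpow_add₀ hq, zpow_natCast]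
    norm_cast

/-! ### Specialization to powers of `q`: the finite Rogers–Ramanujan type identities. -/

/-- `(-1)^k q^{k(k-1)/2}`. -/
def signedTriangular (q : ℂ) (k : ℤ) : ℂ := (-1) ^ k * q ^ (k * (k - 1) / 2)

theorem signedTriangular_natCast {q : ℂ} (hq : q ≠ 0) (k : ℕ) :
    signedTriangular q k = ∏ j ∈ Finset.range k, (-q ^ j) := by
  induction k with
  | zero => simp [signedTriangular]
  | succ k ih =>
    rw [prod_neg_pow_succ, ← ih, signedTriangular, signedTriangular,
      show ((k + 1 : ℕ) : ℤ) * (((k + 1 : ℕ) : ℤ) - 1) = (k : ℤ) * (k - 1) + k * 2 by push_cast; ring,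
      Int.add_mul_ediv_right _ _ two_ne_zero, zpow_add₀ hq, Nat.cast_succ,
      zpow_add₀ (by norm_num), zpow_natCast q k]
    ring

theorem signedTriangular_neg {q : ℂ} (hq : q ≠ 0) (k : ℤ) :
    signedTriangular q (-k) = signedTriangular q k * q ^ k := by
  rw [signedTriangular, signedTriangular, show -k * (-k - 1) = k * (k - 1) + k * 2 by ring,
    Int.add_mul_ediv_right _ _ two_ne_zero, zpow_add₀ hq, zpow_neg, ← inv_zpow]
  norm_num
  ring

theorem signedTriangular_pow_five {q : ℂ} (hq : q ≠ 0) (r k p : ℤ) (hr : 5 - r = 2 * p) :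
    signedTriangular q k ^ 5 * q ^ (p * k) = (-1) ^ k * q ^ ((5 * k ^ 2 - r * k) / 2) := by
  obtain ⟨T, hT⟩ : ∃ T, k * (k - 1) = T * 2 :=
    ⟨_, (Int.ediv_mul_cancel (Int.even_mul_pred_self k).two_dvd).symm⟩
  have e1 : k * (k - 1) / 2 = T := by rw [hT]; omega
  have e2 : (5 * k ^ 2 - r * k) / 2 = T * 5 + p * k := by
    have : 5 * k ^ 2 - r * k = (T * 5 + p * k) * 2 := by
      linear_combination 5 * hT + k * hr
    rw [this]; omega
  have e3 : ((-1 : ℂ) ^ k) ^ 5 = (-1) ^ k := by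
    rcases Int.even_or_odd k with h | h
    · rw [h.neg_one_zpow]; norm_num
    · rw [h.neg_one_zpow]; norm_num
  rw [signedTriangular, e1, e2, mul_pow, e3, zpow_add₀ hq, zpow_mul q T 5]
  norm_cast
  ring

/-- For `k < 0` the numerator and the denominator exchange roles, and with them `L` and `p`; writing
the result with `qRecip` and `signedTriangular` gives one formula for both signs of `k`. -/
theorem qPoch_ratio_pow {q : ℂ} (hq : q ≠ 0) (h1 : ∀ n : ℕ, 1 - q ^ (n + 1) ≠ 0) (L p : ℕ)
    (k : ℤ) :
    qPoch q (q / q ^ (L + 1)) k / qPoch q (q ^ (p + 1)) k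
      = qShift q q L * qShift q q p * (qRecip q (L - k) * qRecip q (p + k))
        * signedTriangular q k * ((q ^ L) ^ k)⁻¹ := by
  have hL : ∀ i : ℕ, (q ^ L) ^ i ≠ 0 := fun i => pow_ne_zero _ (pow_ne_zero _ hq)
  have hp : ∀ i : ℕ, (q ^ p) ^ i ≠ 0 := fun i => pow_ne_zero _ (pow_ne_zero _ hq)
  rcases Int.eq_nat_or_neg k with ⟨i, rfl | rfl⟩
  · have hA := qShift_div_pow hq h1 L i
    rw [← eq_div_iff (hL i)] at hA
    rw [qPoch_natCast, qPoch_natCast, div_eq_mul_inv, qShift_pow_succ h1, hA,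
      signedTriangular_natCast hq, zpow_natCast]
    ring
  · have hA := qShift_div_pow hq h1 p i
    rw [← eq_div_iff (hp i)] at hA
    have e : (q ^ (p + 1) / (q / q ^ (L + 1))) ^ i = (q ^ p) ^ i * (q ^ L) ^ i * q ^ i := by
      rw [← mul_pow, ← mul_pow]
      congr 1
      field_simp
      ring
    rw [qPoch_neg_div hq (div_ne_zero hq (pow_ne_zero _ hq)) (pow_ne_zero _ hq),
      div_div_cancel₀ hq, e, div_eq_mul_inv, qShift_pow_succ h1, hA, signedTriangular_neg hq,
      signedTriangular_natCast hq, zpow_natCast, zpow_neg, inv_inv, zpow_natCast, sub_neg_eq_add,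
      ← sub_eq_add_neg]
    have := hp i
    field_simp

/-- Source of `q^{k²}`: three truncating numerators over one truncating denominator leave the square
of `∏ (-q^j)`, and the series supplies the extra `q^k`. -/
theorem prod_neg_pow_sq (q : ℂ) (k : ℕ) :
    (∏ j ∈ Finset.range k, (-q ^ j)) ^ 2 * q ^ k = q ^ (k ^ 2) := by
  induction k with
  | zero => simp
  | succ k ih =>
    rw [prod_neg_pow_succ, show (k + 1) ^ 2 = k ^ 2 + (2 * k + 1) by ring, pow_add q (k ^ 2), ← ih]
    ring

theorem finiteRRLeftTerm_eq {q : ℂ} (hq : q ≠ 0) (h1 : ∀ n : ℕ, 1 - q ^ (n + 1) ≠ 0)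
    (l m n U V t k : ℕ) :
    qShift q q l * qShift q q m * qShift q q n * qShift q q (U + 1) * qShift q q (V + 1)
        * finiteRRLeftTerm q l m n (U + 1) (V + 1) t k
      = qShift q q (l + m + n) * qShift q q (U + V + 1)
        * unilateralTerm q (q ^ (l + 1)) (q ^ (m + 1)) (q ^ (n + 1)) (q ^ (U + 1 + 1))
          (q ^ (V + 1 + 1)) (t + 1) k := by
  have A : ∀ N : ℕ, qShift q (q / q ^ (N + 1)) k
      = (∏ j ∈ Finset.range k, (-q ^ j)) * (qShift q q N * qRecip q ((N : ℤ) - k))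
        / (q ^ N) ^ k := fun N =>
    eq_div_of_mul_eq (pow_ne_zero _ (pow_ne_zero _ hq)) (qShift_div_pow hq h1 N k)
  have hX : ∏ j ∈ Finset.range k, (-q ^ j) ≠ 0 :=
    Finset.prod_ne_zero_iff.mpr fun j _ => neg_ne_zero.mpr (pow_ne_zero _ hq)
  have Q := prod_neg_pow_sq q k
  have e1 : q ^ 3 / (q ^ (l + 1) * q ^ (m + 1) * q ^ (n + 1)) = q / q ^ (l + m + n + 1) := by
    field_simp
    ring
  have e2 : q ^ (U + 1 + 1) * q ^ (V + 1 + 1) / q ^ 2 = q ^ (U + V + 1 + 1) := by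
    field_simp
    ring
  have B : ∀ N : ℕ, (qShift q (q ^ (N + 1)) k)⁻¹ = qShift q q N * qRecip q ((N : ℤ) + k) :=
    fun N => qShift_pow_succ h1 N k
  have B' : qShift q (q ^ (U + V + 1 + 1)) k
      = (qShift q q (U + V + 1))⁻¹ * qPoch q q (((U + V + 1 : ℕ) : ℤ) + k) := by
    rw [← inv_inv (qShift q _ k), B, mul_inv, qRecip, inv_inv]
  have C : (qRecip q (((l + m + n : ℕ) : ℤ) - k))⁻¹ = qPoch q q ((l : ℤ) + m + n - k) := by
    rw [qRecip, inv_inv]; push_cast; rfl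
  have e3 : ((U + 1 : ℕ) : ℤ) + ((V + 1 : ℕ) : ℤ) + k - 1 = ((U + V + 1 : ℕ) : ℤ) + k := by
    push_cast; ring
  have S := qShift_self_ne_zero h1
  have pw : (q ^ (l + m + n)) ^ k = (q ^ l) ^ k * (q ^ m) ^ k * (q ^ n) ^ k := by
    rw [← mul_pow, ← mul_pow, ← pow_add, ← pow_add]
  have lhs : finiteRRLeftTerm q l m n (U + 1) (V + 1) t k
      = q ^ (k ^ 2 + t * k) * (qPoch q q ((l : ℤ) + m + n - k)
        * qPoch q q (((U + V + 1 : ℕ) : ℤ) + k)) * ((qShift q q k)⁻¹ * qRecip q ((l : ℤ) - k)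
        * qRecip q ((m : ℤ) - k) * qRecip q ((n : ℤ) - k) * qRecip q (((U + 1 : ℕ) : ℤ) + k)
        * qRecip q (((V + 1 : ℕ) : ℤ) + k)) := by
    rw [finiteRRLeftTerm, e3]
    simp only [div_eq_mul_inv, mul_inv, qRecip, qPoch_natCast]
  rw [lhs]
  clear lhs
  simp only [unilateralTerm, qPochs, List.map_cons, List.map_nil, List.prod_cons, List.prod_nil,
    mul_one, qPoch_natCast]
  rw [e1, e2, B', A l, A m, A n, A (l + m + n), pw]
  simp only [div_eq_mul_inv, mul_inv, inv_inv]
  rw [B (U + 1), B (V + 1), C, pow_add, ← Q, add_mul, one_mul, pow_add]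
  have s1 := mul_inv_cancel₀ (S (l + m + n))
  have s2 := mul_inv_cancel₀ (S (U + V + 1))
  have hx : ∀ N : ℕ, (q ^ N) ^ k * ((q ^ N) ^ k)⁻¹ = 1 := fun N =>
    mul_inv_cancel₀ (pow_ne_zero _ (pow_ne_zero _ hq))
  have hl := hx l
  have hm := hx m
  have hn := hx n
  replace hX := mul_inv_cancel₀ hX
  clear Q A B B' C S e1 e2 e3 pw hx
  generalize qShift q q (l + m + n) = y1 at *
  generalize qShift q q (U + V + 1) = y2 at *
  generalize (q ^ l) ^ k = x1 at *
  generalize (q ^ m) ^ k = x2 at *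
  generalize (q ^ n) ^ k = x3 at *
  generalize ∏ j ∈ Finset.range k, (-q ^ j) = X at *
  generalize y1⁻¹ = y1' at *
  generalize y2⁻¹ = y2' at *
  generalize x1⁻¹ = x1' at *
  generalize x2⁻¹ = x2' at *
  generalize x3⁻¹ = x3' at *
  generalize X⁻¹ = X' at *
  symm
  calc _ = (y1 * y1') * (y2 * y2') * (x1 * x1') * (x2 * x2') * (x3 * x3') * (X * X')
        * (qShift q q l * qShift q q m * qShift q q n * qShift q q (U + 1) * qShift q q (V + 1)
        * (X ^ 2 * q ^ k * q ^ (t * k) * (qPoch q q ((l : ℤ) + m + n - k)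
        * qPoch q q (((U + V + 1 : ℕ) : ℤ) + k)) * ((qShift q q k)⁻¹ * qRecip q ((l : ℤ) - k)
        * qRecip q ((m : ℤ) - k) * qRecip q ((n : ℤ) - k) * qRecip q (((U + 1 : ℕ) : ℤ) + k)
        * qRecip q (((V + 1 : ℕ) : ℤ) + k)))) := by ring
    _ = _ := by rw [s1, s2, hl, hm, hn, hX]; ring

theorem finiteRRRightTerm_eq {q : ℂ} (hq : q ≠ 0) (h1 : ∀ n : ℕ, 1 - q ^ (n + 1) ≠ 0)
    (l m n U V s : ℕ) (r : ℤ) (hr : 5 + r = 2 * s) (k : ℤ) :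
    qShift q q l ^ 2 * qShift q q m ^ 2 * qShift q q n ^ 2 * qShift q q (U + 1)
        * qShift q q (V + 1) * finiteRRRightTerm q l m n (U + 1) (V + 1) r k
      = qShift q q (l + m) * qShift q q (l + n) * qShift q q (m + n) * qShift q q (U + V + 1)
        * bilateralTerm q (q ^ (l + 1)) (q ^ (m + 1)) (q ^ (n + 1)) (q ^ (U + 1 + 1))
          (q ^ (V + 1 + 1)) s k := by
  have Y := signedTriangular_pow_five hq r k (5 - s) (by linarith)
  have P := fun L p => qPoch_ratio_pow hq h1 L p k
  have eU : q ^ (U + 1 + 1) / q = q ^ (U + 1) := by field_simp; ring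
  have eV : q ^ (V + 1 + 1) / q = q ^ (V + 1) := by field_simp; ring
  have z : ((q ^ l) ^ k)⁻¹ * ((q ^ m) ^ k)⁻¹ * ((q ^ n) ^ k)⁻¹ * ((q ^ (U + 1)) ^ k)⁻¹
      * ((q ^ (V + 1)) ^ k)⁻¹ * (q ^ (l + 1) * q ^ (m + 1) * q ^ (n + 1) * q ^ (U + 1 + 1)
        * q ^ (V + 1 + 1) / q ^ s) ^ k = q ^ ((5 - (s : ℤ)) * k) := by
    rw [zpow_mul, ← inv_zpow, ← inv_zpow, ← inv_zpow, ← inv_zpow, ← inv_zpow, ← mul_zpow,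
      ← mul_zpow, ← mul_zpow, ← mul_zpow, ← mul_zpow, zpow_sub₀ hq, zpow_natCast]
    congr 1
    norm_cast
    field_simp
    ring
  rw [bilateralTerm]
  simp only [qPochs, List.map_cons, List.map_nil, List.prod_cons, List.prod_nil, mul_one]
  rw [eU, eV]
  have split : ∀ a b c d e a' b' c' d' e' : ℂ, a * (b * (c * (d * e))) / (a' * (b' * (c' * (d' * e'))))
      = a / a' * (b / b') * (c / c') * (d / d') * (e / e') := by
    intros; simp only [div_eq_mul_inv, mul_inv]; ring
  -- The last two ratios are not symmetric: `q/d = q/q^{U+2}` but `d/q = q^{U+1}`, hence the pair `U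
  -- + 1`, `U`. This yields `(q)_{u-k}` and `(q)_{u+k-1}` for `u = U + 1`, and likewise for `e` with
  -- `V`.
  rw [split, P l l, P m m, P n n, P (U + 1) U, P (V + 1) V]
  have lhs : finiteRRRightTerm q l m n (U + 1) (V + 1) r k
      = (-1) ^ k * q ^ ((5 * k ^ 2 - r * k) / 2)
        * (qShift q q (l + m) * qShift q q (l + n) * qShift q q (m + n) * qShift q q U
          * qShift q q V * qShift q q (U + V + 1))
        * (qRecip q (l - k) * qRecip q (m - k) * qRecip q (n - k) * qRecip q ((U + 1 : ℕ) - k)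
          * qRecip q ((V + 1 : ℕ) - k) * qRecip q (l + k) * qRecip q (m + k) * qRecip q (n + k)
          * qRecip q (U + k) * qRecip q (V + k)) := by
    have i1 : ((U + 1 : ℕ) : ℤ) - 1 = (U : ℤ) := by push_cast; ring
    have i2 : ((V + 1 : ℕ) : ℤ) - 1 = (V : ℤ) := by push_cast; ring
    have i3 : ((U + 1 : ℕ) : ℤ) + (V + 1 : ℕ) - 1 = ((U + V + 1 : ℕ) : ℤ) := by push_cast; ring
    have i4 : ((U + 1 : ℕ) : ℤ) + k - 1 = U + k := by push_cast; ring
    have i5 : ((V + 1 : ℕ) : ℤ) + k - 1 = V + k := by push_cast; ring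
    rw [finiteRRRightTerm, i1, i2, i3, i4, i5, ← Nat.cast_add, ← Nat.cast_add, ← Nat.cast_add]
    simp only [qPoch_natCast, div_eq_mul_inv, mul_inv, qRecip]
  rw [lhs, ← Y, ← z]
  ring

theorem prefactor_pow {q : ℂ} (hq : q ≠ 0) (hq1 : ‖q‖ < 1) (l m n : ℕ) :
    prefactor q (q ^ (l + 1)) (q ^ (m + 1)) (q ^ (n + 1))
      = qShift q q l * qShift q q m * qShift q q n * qShift q q (l + m + n)
        / (qShift q q (l + m) * qShift q q (l + n) * qShift q q (m + n)) := by
  have h1 := one_sub_pow_succ_ne_zero hq1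
  have S := qShift_self_ne_zero h1
  have A : ∀ M N : ℕ, qShift q (q ^ (M + 1)) N = qShift q q (M + N) / qShift q q M := by
    intro M N
    rw [qShift_add, ← pow_succ', mul_div_cancel_left₀ _ (S M)]
  have e : q ^ (m + 1) * q ^ (n + 1) / q = q ^ (m + n + 1) := by field_simp; ring
  rw [prefactor_pow_succ hq hq1 h1 (pow_succ_shift_ne h1 m) (pow_succ_shift_ne h1 n) l ?_,
    e, A, A, A, show m + n + l = l + m + n by ring, add_comm m l, add_comm n l]
  · have := S (m + n)
    have := S m
    have := S n
    have := S (l + m)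
    have := S (l + n)
    field_simp
  · intro j
    have := h1 (l + m + n + j)
    convert this using 2
    field_simp
    ring

/-- Both summands are multiples of those of the transformation by constants independent of `k`, and
`prefactor_pow` supplies exactly the quotient of these constants. -/
theorem finiteRR_of_transformation {q : ℂ} (hq : q ≠ 0) (hq1 : ‖q‖ < 1)
    (l m n U V s t : ℕ) (r : ℤ) (hr : 5 + r = 2 * s)
    (H : Summable (bilateralTerm q (q ^ (l + 1)) (q ^ (m + 1)) (q ^ (n + 1)) (q ^ (U + 1 + 1))
          (q ^ (V + 1 + 1)) s)
      ∧ Summable (unilateralTerm q (q ^ (l + 1)) (q ^ (m + 1)) (q ^ (n + 1)) (q ^ (U + 1 + 1))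
          (q ^ (V + 1 + 1)) (t + 1))
      ∧ ∑' k : ℤ, bilateralTerm q (q ^ (l + 1)) (q ^ (m + 1)) (q ^ (n + 1)) (q ^ (U + 1 + 1))
          (q ^ (V + 1 + 1)) s k
        = prefactor q (q ^ (l + 1)) (q ^ (m + 1)) (q ^ (n + 1))
          * ∑' k : ℕ, unilateralTerm q (q ^ (l + 1)) (q ^ (m + 1)) (q ^ (n + 1)) (q ^ (U + 1 + 1))
            (q ^ (V + 1 + 1)) (t + 1) k) :
    Summable (finiteRRLeftTerm q l m n (U + 1) (V + 1) t)
      ∧ Summable (finiteRRRightTerm q l m n (U + 1) (V + 1) r)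
      ∧ ∑' k : ℕ, finiteRRLeftTerm q l m n (U + 1) (V + 1) t k
        = ∑' k : ℤ, finiteRRRightTerm q l m n (U + 1) (V + 1) r k := by
  obtain ⟨HB, HU, HE⟩ := H
  have h1 := one_sub_pow_succ_ne_zero hq1
  have S := qShift_self_ne_zero h1
  have sl := S l
  have sm := S m
  have sn := S n
  have su := S (U + 1)
  have sv := S (V + 1)
  have slm := S (l + m)
  have sln := S (l + n)
  have smn := S (m + n)
  have nL : qShift q q l * qShift q q m * qShift q q n * qShift q q (U + 1)
      * qShift q q (V + 1) ≠ 0 := by positivity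
  have nR : qShift q q l ^ 2 * qShift q q m ^ 2 * qShift q q n ^ 2 * qShift q q (U + 1)
      * qShift q q (V + 1) ≠ 0 := by positivity
  have eL := funext fun k => eq_div_of_mul_eq nL
    ((mul_comm _ _).trans (finiteRRLeftTerm_eq hq h1 l m n U V t k))
  have eR := funext fun k => eq_div_of_mul_eq nR
    ((mul_comm _ _).trans (finiteRRRightTerm_eq hq h1 l m n U V s r hr k))
  rw [eL, eR]
  refine ⟨(HU.mul_left _).div_const _, (HB.mul_left _).div_const _, ?_⟩
  rw [tsum_div_const, tsum_div_const, tsum_mul_left, tsum_mul_left, HE, prefactor_pow hq hq1]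
  field_simp

theorem finiteRR {q : ℂ} (hq : q ≠ 0) (hq1 : ‖q‖ < 1) (l m n U V : ℕ) :
    (Summable (finiteRRLeftTerm q l m n (U + 1) (V + 1) 0)
        ∧ Summable (finiteRRRightTerm q l m n (U + 1) (V + 1) 1)
        ∧ ∑' k : ℕ, finiteRRLeftTerm q l m n (U + 1) (V + 1) 0 k
          = ∑' k : ℤ, finiteRRRightTerm q l m n (U + 1) (V + 1) 1 k) ∧
      (Summable (finiteRRLeftTerm q l m n (U + 1) (V + 1) 1)
        ∧ Summable (finiteRRRightTerm q l m n (U + 1) (V + 1) 3)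
        ∧ ∑' k : ℕ, finiteRRLeftTerm q l m n (U + 1) (V + 1) 1 k
          = ∑' k : ℤ, finiteRRRightTerm q l m n (U + 1) (V + 1) 3 k) := by
  have h1 := one_sub_pow_succ_ne_zero hq1
  have hp : ∀ i : ℕ, q ^ i ≠ 0 := fun i => pow_ne_zero _ hq
  have hne : ∀ W : ℕ, q ^ (W + 1 + 1) ≠ q := fun W h =>
    h1 W (by rw [pow_succ q (W + 1), mul_eq_right₀ hq] at h; rw [h, sub_self])
  have H := bilateral_transformation hq hq1 h1 (hp (m + 1)) (hp (n + 1)) (hp (U + 1 + 1))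
    (hp (V + 1 + 1)) (pow_succ_shift_ne h1 m) (pow_succ_shift_ne h1 n) (N := l)
    (fun j => by
      convert h1 (l + m + n + j) using 2
      field_simp
      ring)
    (fun j hj h => by
      obtain ⟨t, rfl⟩ := Nat.exists_eq_add_of_lt hj
      apply h1 (t + m + n)
      have h' := sub_eq_zero.mp h
      rw [div_mul_eq_mul_div, eq_div_iff (mul_ne_zero (mul_ne_zero (hp _) (hp _)) (hp _)),
        one_mul] at h'
      have e : q ^ (j + t + 1 + 1) * q ^ (m + 1) * q ^ (n + 1)
          = q ^ (t + m + n + 1) * (q ^ 3 * q ^ j) := by ring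
      rw [e, mul_eq_right₀ (mul_ne_zero (hp _) (hp _))] at h'
      rw [h', sub_self])
    (fun j _ => pow_succ_shift_ne h1 _ j) (fun j _ => pow_succ_shift_ne h1 _ j) (hne U) (hne V)
  exact ⟨finiteRR_of_transformation hq hq1 l m n U V 3 0 1 (by norm_num) H.1,
    finiteRR_of_transformation hq hq1 l m n U V 4 1 3 (by norm_num) H.2⟩

end

theorem theorem1p3 (q : ℂ) (hq0 : 0 < ‖q‖) (hq1 : ‖q‖ < 1) :
    (∀ (a b c d e : ℂ) (n : ℕ),
      1 ≤ n → (a = q ^ n ∨ b = q ^ n ∨ c = q ^ n) →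
      a ≠ 0 → b ≠ 0 → c ≠ 0 → d ≠ 0 → e ≠ 0 →
      -- no denominator vanishes in the prefactor, nor in the terms that are not cut off
      (∀ i : ℤ, i ≤ 0 → a ≠ q ^ i ∧ b ≠ q ^ i ∧ c ≠ q ^ i) →
      (∀ i : ℤ, i ≤ (n : ℤ) + 1 → a * b * c ≠ q ^ i) →
      (∀ i : ℤ, 2 - (n : ℤ) ≤ i → i ≤ 1 → d ≠ q ^ i ∧ e ≠ q ^ i) →
      ((Summable (bilateralTerm q a b c d e 3) ∧ Summable (unilateralTerm q a b c d e 1) ∧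
        ∑' k : ℤ, bilateralTerm q a b c d e 3 k
          = prefactor q a b c * ∑' k : ℕ, unilateralTerm q a b c d e 1 k) ∧
      (Summable (bilateralTerm q a b c d e 4) ∧ Summable (unilateralTerm q a b c d e 2) ∧
        ∑' k : ℤ, bilateralTerm q a b c d e 4 k
          = prefactor q a b c * ∑' k : ℕ, unilateralTerm q a b c d e 2 k))) ∧
    (∀ l m n u v : ℕ, 1 ≤ u → 1 ≤ v →
      ((Summable (finiteRRLeftTerm q l m n u v 0) ∧ Summable (finiteRRRightTerm q l m n u v 1) ∧
        ∑' k : ℕ, finiteRRLeftTerm q l m n u v 0 k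
          = ∑' k : ℤ, finiteRRRightTerm q l m n u v 1 k) ∧
      (Summable (finiteRRLeftTerm q l m n u v 1) ∧ Summable (finiteRRRightTerm q l m n u v 3) ∧
        ∑' k : ℕ, finiteRRLeftTerm q l m n u v 1 k
          = ∑' k : ℤ, finiteRRRightTerm q l m n u v 3 k))) := by
  have hq : q ≠ 0 := norm_pos_iff.mp hq0
  refine ⟨fun a b c d e n hn hpow ha hb hc hd he habc h3 hde => ?_, fun l m n u v hu hv => ?_⟩
  · rcases hpow with h | h | h
    · exact bilateral_transformation_of_eq_pow hq hq1 hn h hb hc hd he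
        (fun i hi => (habc i hi).2) h3 hde
    · simp only [bilateralTerm_swap q a b, unilateralTerm_swap q a b, prefactor_swap q a b]
      exact bilateral_transformation_of_eq_pow hq hq1 hn h ha hc hd he
        (fun i hi => ⟨(habc i hi).1, (habc i hi).2.2⟩)
        (fun i hi => by rw [mul_comm b a]; exact h3 i hi) hde
    · simp only [bilateralTerm_rotate q a b c, unilateralTerm_rotate q a b c,
        prefactor_rotate q a b c]
      exact bilateral_transformation_of_eq_pow hq hq1 hn h ha hb hd he
        (fun i hi => ⟨(habc i hi).1, (habc i hi).2.1⟩)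
        (fun i hi => by rw [show c * a * b = a * b * c by ring]; exact h3 i hi) hde
  · obtain ⟨U, rfl⟩ := Nat.exists_eq_add_of_le' hu
    obtain ⟨V, rfl⟩ := Nat.exists_eq_add_of_le' hv
    exact finiteRR hq hq1 l m n U V
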